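/- Let $\boldsymbol k$ be a field of characteristic $0$. For an element $x$ of a $\mathbb Z$-graded vector space write $|x|'=|x|-1$ for the shifted degree; for a word $\vec a=(a_1,\dots,a_p)$ of homogeneous elements write $|\vec a|'=\sum|a_i|'$. **Conventions.** An $A_\infty$-algebra $(A,\{m_k\}_{k\ge1})$ is a $\mathbb Z$-graded vector space with multilinear maps $m_k:A^{\otimes k}\to A$ of shifted degree $1$ such that $\sum_{l=\vec u\vec v\vec w}(-1)^{|\vec u|'}m(\vec u,m(\vec v),\vec w)=0$ for every word $l$ of homogeneous elements. An $A_\infty$-morphism $h:B\to A$ is a family of multilinear maps $h_k:B^{\otimes k}\to A$, $k\ge 1$, of shifted degree $0$ with $\sum_{l=\vec u\vec v\vec w}(-1)^{|\vec u|'}h(\vec u,m^B(\vec v),\vec w)=\sum_{l=\vec l_1\cdots\vec l_n}m^A_n(h(\vec l_1),\dots,h(\vec l_n))$; it is a quasi-isomorphism if $h_1$ induces an isomorphism on $m_1$-cohomology. Write $\widehat h(l)=\sum_{l=\vec l_1\cdots\vec l_n}h(\vec l_1)\otimes\cdots\otimes h(\vec l_n)$ (non-empty blocks; $\widehat h$ of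 the empty word is $1$). A *strong homotopy inner product* on $A$ is a family of multilinear maps $\phi_{p,q}:A^{\otimes p}\otimes\underline A\otimes A^{\otimes q}\to A^*$ $(p,q\ge0)$ such that, for all words $\vec a,\vec b,\dots$ of homogeneous elements and homogeneous $v,w,\dots$: 1. ($A_\infty$-bimodule map) $$\begin{aligned}&\sum_{\vec a=\vec a_1\vec a_2,\ \vec b=\vec b_1\vec b_2}(-1)^{|\vec a_1|'}\phi(\vec a_1,\underline{m(\vec a_2,v,\vec b_1)},\vec b_2)(w)+\sum_{\vec a=\vec a_1\vec a_2\vec a_3}(-1)^{|\vec a_1|'}\phi(\vec a_1,m(\vec a_2),\vec a_3,\underline v,\vec b)(w)\\&+\sum_{\vec b=\vec b_1\vec b_2\vec b_3}(-1)^{|\vec a|'+|v|'+|\vec b_1|'}\phi(\vec a,\underline v,\vec b_1,m(\vec b_2),\vec b_3)(w)\\&+\sum_{\vec a=\vec a_1\vec a_2,\ \vec b=\vec b_1\vec b_2}(-1)^{|\vec a_1|'(|\vec a_2|'+|v|'+|\vec b|'+|w|')+|\vec a_2|'+|v|'+|\vec b_1|'}\phi(\vec a_2,\underline v,\vec b_1)(m(\vec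 b_2,w,\vec a_1))=0;\end{aligned}$$ 2. (skew symmetry) $\phi(\vec a,\underline v,\vec b)(w)=-(-1)^{(|\vec a|'+|v|')(|\vec b|'+|w|')}\phi(\vec b,\underline w,\vec a)(v)$; 3. (closedness) for every family $(a_1,\dots,a_n)$ and $1\le i<j<k\le n$, $$(-1)^{K_j}\phi(..,\underline{a_i},..)(a_j)+(-1)^{K_k}\phi(..,\underline{a_j},..)(a_k)+(-1)^{K_i}\phi(..,\underline{a_k},..)(a_i)=0,$$ where the arguments are filled in according to the cyclic order of the family, the argument of the functional coming last, and $K_s=(|a_1|'+\cdots+|a_s|')(|a_{s+1}|'+\cdots+|a_n|')$ is the Koszul exponent of the rotation that puts $a_s$ last; 4. (homological non-degeneracy) for each non-zero class $[a]\in H^\bullet(A,m_1)$ there is a class $[b]$ with $\phi_{0,0}(a)(b)\ne0$. A *cyclic* $A_\infty$-algebra is an $A_\infty$-algebra $B$ with a non-degenerate bilinear form $\langle\,,\rangle$ such that $\langle v,w\rangle=-(-1)^{|v|'|w|'}\langle w,v\rangle$ and, for all $k\ge1$, $\langle m_k(x_1,\dots,x_k),x_{k+1}\rangle=(-1)^{|x_1|'(|x_2|'+\cdots+|x_{k+1}|')}\langle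 m_k(x_2,\dots,x_{k+1}),x_1\rangle$. Let $\psi:B\to B^*$ be given by $\psi_{0,0}(v)(w)=\langle v,w\rangle$ and $\psi_{p,q}=0$ for $(p,q)\ne(0,0)$. **Potentials.** Let $A$, $B$ be finite-dimensional with homogeneous bases $\{e_i\}$, $\{f_j\}$, and let $x_i$, $y_j$ be graded-commutative formal variables of degrees $-|e_i|'$, $-|f_j|'$. With $\boldsymbol x=\sum_i e_ix_i$ and $\boldsymbol y=\sum_j f_jy_j$ put $$\Phi^A(\boldsymbol x)=\sum_{N\ge1}\ \sum_{p+q+k=N}\frac1{N+1}\,\phi_{p,q}\big(\boldsymbol x,\dots,\boldsymbol x,\underline{m_k(\boldsymbol x,\dots,\boldsymbol x)},\boldsymbol x,\dots,\boldsymbol x\big)(\boldsymbol x),\qquad \Phi^B(\boldsymbol y)=\sum_{k\ge1}\frac1{k+1}\langle m_k(\boldsymbol y,\dots,\boldsymbol y),\boldsymbol y\rangle .$$ These are formal power series: the coefficient of the monomial $x_{i_1}\cdots x_{i_{N+1}}$, in this order, contributed by the basis word $(e_{i_1},\dots,e_{i_{N+1}})$ is $\frac1{N+1}\sum_{p+k+q=N}(-1)^{|e_{i_1}|'+\cdots+|e_{i_p}|'}\phi_{p,q}(e_{i_1},\dots,e_{i_p},\underline{m_k(e_{i_{p+1}},\dots,e_{i_{p+k}})},e_{i_{p+k+1}},\dots,e_{i_N})(e_{i_{N+1}})$,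 and similarly for $\Phi^B$ (with no sign). For an $A_\infty$-morphism $h:B\to A$ with $h_n(f_{j_1},\dots,f_{j_n})=\sum_ih^i_{j_1\cdots j_n}e_i$, let $h^*\Phi^A$ be the power series in the $y_j$ obtained from $\Phi^A$ by the substitution $$x_i\longmapsto\sum_{n\ge1}\sum_{j_1,\dots,j_n}h^i_{j_1\cdots j_n}\,y_{j_1}\cdots y_{j_n}.$$ **Theorem.** Let $\phi:A\to A^*$ be a strong homotopy inner product on $A$, let $B$ be a cyclic $A_\infty$-algebra, and let $h:B\to A$ be an $A_\infty$-quasi-isomorphism such that $\psi=\widetilde h^*\circ\widehat\phi\circ\widehat{\widetilde h}$, that is, for all words $\vec a,\vec b$ of homogeneous elements and homogeneous $v,w$ of $B$, $$\psi(\vec a,\underline v,\vec b)(w)=\sum_{\vec a=\vec a_1\vec a_2\vec a_3,\ \vec b=\vec b_1\vec b_2\vec b_3}(-1)^{|\vec a_1|'(|\vec a_2|'+|\vec a_3|'+|v|'+|\vec b|'+|w|')}\phi\big(\widehat h(\vec a_2),\underline{h(\vec a_3,v,\vec b_1)},\widehat h(\vec b_2)\big)\big(h(\vec b_3,w,\vec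 a_1)\big).$$ Then $\Phi^B=h^*\Phi^A$ as formal power series in the graded-commutative variables $y_j$. -/

import Mathlib

open scoped BigOperators

noncomputable section

namespace HCyc

/-! ### Words and splittings of words -/

/-- Sum of `f u v` over all ways to write `l = u ++ v`. -/
def sumSplit₂ {α M : Type*} [AddCommMonoid M] (l : List α) (f : List α → List α → M) : M :=
  ∑ i ∈ Finset.range (l.length + 1), f (l.take i) (l.drop i)

/-- Sum of `f u v w` over all ways to write `l = u ++ v ++ w`. -/
def sumSplit₃ {α M : Type*} [AddCommMonoid M] (l : List α)
    (f : List α → List α → List α → M) : M :=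
  sumSplit₂ l fun u r => sumSplit₂ r fun v w => f u v w

section Graded

variable {k : Type*} [Field k]

/-- The sign `(-1)^n` for an integer `n`, in the field `k`. -/
def sgn (k : Type*) [Field k] (n : ℤ) : k := (-1 : k) ^ n

variable {A : Type*} [AddCommGroup A] [Module k A]
variable {B : Type*} [AddCommGroup B] [Module k B]

/-- Homogeneous elements of a `ℤ`-graded vector space, together with their degree. -/
abbrev Homog (𝒜 : ℤ → Submodule k A) : Type _ := Σ n : ℤ, 𝒜 n

/-- The shifted degree `|a|' = |a| - 1`. -/
def sdeg {𝒜 : ℤ → Submodule k A} (a : Homog 𝒜) : ℤ := a.1 - 1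

/-- The total shifted degree `|a₁|' + ⋯ + |aₙ|'` of a word of homogeneous elements. -/
def wdeg {𝒜 : ℤ → Submodule k A} (l : List (Homog 𝒜)) : ℤ := (l.map sdeg).sum

/-- The tensor `a₁ ⊗ ⋯ ⊗ aₙ`, as an element of the tensor algebra of `A`. -/
def word {𝒜 : ℤ → Submodule k A} (l : List (Homog 𝒜)) : TensorAlgebra k A :=
  (l.map fun a => TensorAlgebra.ι k (a.2 : A)).prod

/-! ### A∞-algebras and their morphisms

A family of multilinear operations `m_n : A^{⊗n} → A` (`n ≥ 0`) is recorded as one linear map on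
the tensor algebra `T A = ⨁ A^{⊗n}`. -/

/-- An A∞-algebra structure (`m₀ = 0`) on the `ℤ`-graded vector space `(A, 𝒜)`, in the sign
convention where all signs are Koszul signs for the shifted degrees `|a|' = |a| - 1`. -/
structure AInfAlgebra (𝒜 : ℤ → Submodule k A) where
  /-- the operations `m_n`, all `n` at once -/
  m : TensorAlgebra k A →ₗ[k] A
  m_zero : m 1 = 0
  /-- each `m_n` has degree `1` for the shifted degrees -/
  m_degree : ∀ l : List (Homog 𝒜), m (word l) ∈ 𝒜 (wdeg l + 2)
  /-- `∑ (-1)^{|u|'} m(u, m(v), w) = 0` -/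
  m_rel : ∀ l : List (Homog 𝒜),
    sumSplit₃ l (fun u v w =>
      sgn k (wdeg u) • m (word u * TensorAlgebra.ι k (m (word v)) * word w)) = 0

/-- The differential `m₁`. -/
def AInfAlgebra.d {𝒜 : ℤ → Submodule k A} (M : AInfAlgebra 𝒜) (a : A) : A :=
  M.m (TensorAlgebra.ι k a)

/-- Given a family `h_n : A^{⊗n} → B` (with `h₀ = 0`) this is the component with `n` blocks of the
induced map of tensor coalgebras: the sum of `h(l₁) ⊗ ⋯ ⊗ h(lₙ)` over all ways to write
`l = l₁ ++ ⋯ ++ lₙ`. -/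
def blocks {𝒜 : ℤ → Submodule k A} (h : TensorAlgebra k A →ₗ[k] B) :
    ℕ → List (Homog 𝒜) → TensorAlgebra k B
  | 0, [] => 1
  | 0, _ :: _ => 0
  | n + 1, l => sumSplit₂ l fun u v => TensorAlgebra.ι k (h (word u)) * blocks h n v

/-- The map of tensor coalgebras `ĥ : T A → T B` induced by `h_n : A^{⊗n} → B` (with `h₀ = 0`),
on words of homogeneous elements. As `h₀ = 0`, at most `l.length` blocks contribute. -/
def hatMap {𝒜 : ℤ → Submodule k A} (h : TensorAlgebra k A →ₗ[k] B) (l : List (Homog 𝒜)) :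
    TensorAlgebra k B :=
  ∑ n ∈ Finset.range (l.length + 1), blocks h n l

/-- An A∞-morphism `h : A → B`, with components `h_n : A^{⊗n} → B`, `n ≥ 1`. -/
structure AInfHom {𝒜 : ℤ → Submodule k A} {ℬ : ℤ → Submodule k B}
    (M : AInfAlgebra 𝒜) (N : AInfAlgebra ℬ) where
  /-- the components `h_n`, all `n` at once -/
  h : TensorAlgebra k A →ₗ[k] B
  h_zero : h 1 = 0
  /-- each `h_n` has degree `0` for the shifted degrees -/
  h_degree : ∀ l : List (Homog 𝒜), h (word l) ∈ ℬ (wdeg l + 1)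
  /-- `∑ (-1)^{|u|'} h(u, m(v), w) = ∑ m(h(l₁), …, h(lₙ))` -/
  h_rel : ∀ l : List (Homog 𝒜),
    sumSplit₃ l (fun u v w =>
      sgn k (wdeg u) • h (word u * TensorAlgebra.ι k (M.m (word v)) * word w)) =
    N.m (hatMap h l)

/-- `h` is an A∞-quasi-isomorphism: `h₁` induces an injective and surjective map on the cohomology
of the differentials `m₁`. -/
structure AInfHom.IsQuasiIso {𝒜 : ℤ → Submodule k A} {ℬ : ℤ → Submodule k B}
    {M : AInfAlgebra 𝒜} {N : AInfAlgebra ℬ} (F : AInfHom M N) : Prop where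
  injective : ∀ a : A, M.d a = 0 → (∃ b : B, F.h (TensorAlgebra.ι k a) = N.d b) →
    ∃ a' : A, a = M.d a'
  surjective : ∀ b : B, N.d b = 0 →
    ∃ a : A, M.d a = 0 ∧ ∃ b' : B, b = F.h (TensorAlgebra.ι k a) + N.d b'

/-! ### Bimodule maps `A → A^*` -/

/-- The components of a (pre-)bimodule map `φ : A → A^*`: a family of multilinear maps
`φ_{p,q} : A^{⊗p} ⊗ A ⊗ A^{⊗q} → A^*`, all `p` and `q` at once; `φ a v b w` is
`φ(a, v, b)(w)`, with `v` the bimodule entry. -/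
abbrev PreBimod (k A : Type*) [Field k] [AddCommGroup A] [Module k A] : Type _ :=
  TensorAlgebra k A →ₗ[k] A →ₗ[k] TensorAlgebra k A →ₗ[k] Module.Dual k A

/-- `φ` is an A∞-bimodule map `A → A^*`, for the canonical bimodule structure on `A^*`:
the operations `m` are inserted, with Koszul signs, in all places of the cyclic word
`a, v, b, w` where they do not meet both `v` and `w`. No condition on the degree of `φ` is imposed,
so pairings of any degree are covered. -/
def IsBimoduleMap {𝒜 : ℤ → Submodule k A} (M : AInfAlgebra 𝒜) (φ : PreBimod k A) : Prop :=
  ∀ (a b : List (Homog 𝒜)) (v w : Homog 𝒜),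
    -- `∑ ± φ(a₁, m(a₂, v, b₁), b₂)(w)`
    sumSplit₂ a (fun a₁ a₂ => sumSplit₂ b fun b₁ b₂ =>
        sgn k (wdeg a₁) * φ (word a₁) (M.m (word (a₂ ++ v :: b₁))) (word b₂) w.2)
    -- `∑ ± φ(a₁, m(a₂), a₃, v, b)(w)`
    + sumSplit₃ a (fun a₁ a₂ a₃ =>
        sgn k (wdeg a₁) *
          φ (word a₁ * TensorAlgebra.ι k (M.m (word a₂)) * word a₃) v.2 (word b) w.2)
    -- `∑ ± φ(a, v, b₁, m(b₂), b₃)(w)`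
    + sumSplit₃ b (fun b₁ b₂ b₃ =>
        sgn k (wdeg a + sdeg v + wdeg b₁) *
          φ (word a) v.2 (word b₁ * TensorAlgebra.ι k (M.m (word b₂)) * word b₃) w.2)
    -- `∑ ± φ(a₂, v, b₁)(m(b₂, w, a₁))`
    + sumSplit₂ a (fun a₁ a₂ => sumSplit₂ b fun b₁ b₂ =>
        sgn k (wdeg a₁ * (wdeg a₂ + sdeg v + wdeg b + sdeg w)) *
          sgn k (wdeg a₂ + sdeg v + wdeg b₁) *
          φ (word a₂) v.2 (word b₁) (M.m (word (b₂ ++ w :: a₁))))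
    = 0

/-- Skew symmetry: `φ(a, v, b)(w) = - (-1)^K φ(b, w, a)(v)`, with
`K = (|a|' + |v|') (|b|' + |w|')`. -/
def IsSkew (𝒜 : ℤ → Submodule k A) (φ : PreBimod k A) : Prop :=
  ∀ (a b : List (Homog 𝒜)) (v w : Homog 𝒜),
    φ (word a) v.2 (word b) w.2 =
      - (sgn k ((wdeg a + sdeg v) * (wdeg b + sdeg w)) * φ (word b) w.2 (word a) v.2)

/-- Closedness. The family is `u, x, s, y, t, z, r`, with `x, y, z` the three chosen elements; the
arguments of each term are in the cyclic order of the family, the argument of the functional comes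
last, and the sign is the Koszul sign of the cyclic rotation. -/
def IsClosedForm (𝒜 : ℤ → Submodule k A) (φ : PreBimod k A) : Prop :=
  ∀ (u s t r : List (Homog 𝒜)) (x y z : Homog 𝒜),
    sgn k ((wdeg u + sdeg x + wdeg s + sdeg y) * (wdeg t + sdeg z + wdeg r)) *
        φ (word (t ++ z :: (r ++ u))) x.2 (word s) y.2
    + sgn k ((wdeg u + sdeg x + wdeg s + sdeg y + wdeg t + sdeg z) * wdeg r) *
        φ (word (r ++ (u ++ x :: s))) y.2 (word t) z.2
    + sgn k ((wdeg u + sdeg x) * (wdeg s + sdeg y + wdeg t + sdeg z + wdeg r)) *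
        φ (word (s ++ y :: t)) z.2 (word (r ++ u)) x.2
    = 0

/-- A strong homotopy inner product on an A∞-algebra. -/
structure IsStrongHomotopyInnerProduct {𝒜 : ℤ → Submodule k A} (M : AInfAlgebra 𝒜)
    (φ : PreBimod k A) : Prop where
  bimodule : IsBimoduleMap M φ
  skew : IsSkew 𝒜 φ
  closed : IsClosedForm 𝒜 φ
  /-- homological non-degeneracy: for every non-zero class `[a]` there is a class `[b]` with
  `φ_{0,0}(a)(b) ≠ 0` -/
  nondegenerate : ∀ a : A, M.d a = 0 → (¬ ∃ a' : A, a = M.d a') →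
    ∃ b : A, M.d b = 0 ∧ φ 1 a 1 b ≠ 0

/-- A cyclic inner product on an A∞-algebra. -/
structure CyclicInnerProduct {𝒜 : ℤ → Submodule k A} (M : AInfAlgebra 𝒜) where
  form : A →ₗ[k] A →ₗ[k] k
  /-- (graded) skew symmetry -/
  skew : ∀ v w : Homog 𝒜, form v.2 w.2 = - (sgn k (sdeg v * sdeg w) * form w.2 v.2)
  nondegenerate : form.Nondegenerate
  /-- `⟨m(x₁, …, x_n), x_{n+1}⟩ = (-1)^K ⟨m(x₂, …, x_{n+1}), x₁⟩`, with
  `K = |x₁|' (|x₂|' + ⋯ + |x_{n+1}|')` -/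
  cyclic : ∀ (x₁ : Homog 𝒜) (l : List (Homog 𝒜)) (y : Homog 𝒜),
    form (M.m (word (x₁ :: l))) y.2 =
      sgn k (sdeg x₁ * (wdeg l + sdeg y)) * form (M.m (word (l ++ [y]))) x₁.2

/-- A cyclic inner product as a bimodule map `ψ : A → A^*`: `ψ_{0,0}(v)(w) = ⟨v, w⟩`, and
`ψ_{p,q} = 0` for `(p,q) ≠ (0,0)`. -/
def CyclicInnerProduct.toBimod {𝒜 : ℤ → Submodule k A} {M : AInfAlgebra 𝒜}
    (c : CyclicInnerProduct M) : PreBimod k A :=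
  LinearMap.mk₂ k
    (fun (a : TensorAlgebra k A) (v : A) =>
      ((TensorAlgebra.algebraMapInv a : k) •
        (TensorAlgebra.algebraMapInv (R := k) (M := A)).toLinearMap.smulRight (c.form v)))
    (by intro a a' v; simp [add_smul])
    (by intro r a v; simp [mul_smul])
    (by intro a v v'; ext; simp)
    (by intro r a v; ext; simp [mul_left_comm])

theorem CyclicInnerProduct.toBimod_apply {𝒜 : ℤ → Submodule k A} {M : AInfAlgebra 𝒜}
    (c : CyclicInnerProduct M) (a b : TensorAlgebra k A) (v w : A) :
    c.toBimod a v b w =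
      TensorAlgebra.algebraMapInv a * (TensorAlgebra.algebraMapInv b * c.form v w) := by
  simp [CyclicInnerProduct.toBimod]

/-- The pull-back bimodule map `h̃^* ∘ φ̂ ∘ h̃ : B → B^*` of `φ : A → A^*` along an A∞-morphism
`h : B → A`, on words of homogeneous elements:
`(a, v, b)(w) ↦ ∑ ± φ(ĥ(a₂), h(a₃, v, b₁), ĥ(b₂))(h(b₃, w, a₁))`. -/
def pullBimod {𝒜 : ℤ → Submodule k A} {ℬ : ℤ → Submodule k B}
    {M : AInfAlgebra 𝒜} {N : AInfAlgebra ℬ} (F : AInfHom N M) (φ : PreBimod k A)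
    (a : List (Homog ℬ)) (v : Homog ℬ) (b : List (Homog ℬ)) (w : Homog ℬ) : k :=
  sumSplit₃ a fun a₁ a₂ a₃ => sumSplit₃ b fun b₁ b₂ b₃ =>
    sgn k (wdeg a₁ * (wdeg a₂ + wdeg a₃ + sdeg v + wdeg b + sdeg w)) *
      φ (hatMap F.h a₂) (F.h (word (a₃ ++ v :: b₁))) (hatMap F.h b₂)
        (F.h (word (b₃ ++ w :: a₁)))

/-- The square with sides `h̃ : B → A`, `φ : A → A^*`, `h̃^* : A^* → B^*`, `ψ : B → B^*` of
A∞-bimodule maps commutes: `ψ = h̃^* ∘ φ̂ ∘ h̃`. -/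
def SquareCommutes {𝒜 : ℤ → Submodule k A} {ℬ : ℤ → Submodule k B}
    {M : AInfAlgebra 𝒜} {N : AInfAlgebra ℬ} (F : AInfHom N M) (φ : PreBimod k A)
    (ψ : PreBimod k B) : Prop :=
  ∀ (a b : List (Homog ℬ)) (v w : Homog ℬ),
    ψ (word a) v.2 (word b) w.2 = pullBimod F φ a v b w

/-! ### Formal power series in graded-commutative variables -/

/-- The defining relations `x_i x_j = (-1)^{|x_i| |x_j|} x_j x_i`. -/
inductive GCRel (k : Type*) [Field k] {ι : Type*} (deg : ι → ℤ) :
    FreeAlgebra k ι → FreeAlgebra k ι → Prop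
  | comm (i j : ι) : GCRel k deg (FreeAlgebra.ι k i * FreeAlgebra.ι k j)
      (sgn k (deg i * deg j) • (FreeAlgebra.ι k j * FreeAlgebra.ι k i))

/-- Polynomials in graded-commutative variables `x_i` of degrees `deg i`. -/
abbrev GCPoly (k : Type*) [Field k] {ι : Type*} (deg : ι → ℤ) : Type _ := RingQuot (GCRel k deg)

variable {ι κ : Type*} {deg : ι → ℤ} {deg' : κ → ℤ}

/-- The variable `x_i`. -/
def GCPoly.var (k : Type*) [Field k] {ι : Type*} (deg : ι → ℤ) (i : ι) : GCPoly k deg :=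
  RingQuot.mkAlgHom k (GCRel k deg) (FreeAlgebra.ι k i)

/-- The monomial `x_{i₁} ⋯ x_{iₙ}`. -/
def GCPoly.mon (k : Type*) [Field k] {ι : Type*} (deg : ι → ℤ) (I : List ι) : GCPoly k deg :=
  (I.map (GCPoly.var k deg)).prod

/-- The polynomials that are homogeneous of polynomial degree `n`, i.e. the span of the products of
`n` variables. -/
def GCPoly.hom (k : Type*) [Field k] {ι : Type*} (deg : ι → ℤ) (n : ℕ) :
    Submodule k (GCPoly k deg) :=
  Submodule.span k (Set.range (GCPoly.var k deg)) ^ n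

/-- Formal power series in graded-commutative variables: formal sums `∑ₙ fₙ` with `fₙ` a polynomial
homogeneous of polynomial degree `n`, and the Cauchy product. The sum is recorded as the power
series `∑ₙ fₙ Tⁿ` in a bookkeeping variable `T` that commutes with everything. -/
def GCSeries (k : Type*) [Field k] {ι : Type*} (deg : ι → ℤ) :
    Subalgebra k (PowerSeries (GCPoly k deg)) where
  carrier := {f | ∀ n, PowerSeries.coeff n f ∈ GCPoly.hom k deg n}
  mul_mem' := by
    intro f g hf hg n
    rw [PowerSeries.coeff_mul]
    refine Submodule.sum_mem _ fun p hp => ?_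
    rw [← Finset.HasAntidiagonal.mem_antidiagonal.1 hp, GCPoly.hom, pow_add]
    exact Submodule.mul_mem_mul (hf _) (hg _)
  add_mem' := by
    intro f g hf hg n
    rw [map_add]
    exact add_mem (hf n) (hg n)
  algebraMap_mem' := by
    intro r n
    rw [PowerSeries.algebraMap_apply, PowerSeries.coeff_C]
    split_ifs with h
    · subst h
      rw [GCPoly.hom, pow_zero]
      exact Submodule.algebraMap_mem r
    · exact zero_mem _

theorem GCPoly.mon_mem (I : List ι) : GCPoly.mon k deg I ∈ GCPoly.hom k deg I.length := by
  induction I with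
  | nil =>
    simp only [GCPoly.mon, GCPoly.hom, List.map_nil, List.prod_nil, List.length_nil, pow_zero]
    exact Submodule.one_le.1 le_rfl
  | cons i I ih =>
    simp only [GCPoly.mon, GCPoly.hom, List.map_cons, List.prod_cons, List.length_cons, pow_succ']
    exact Submodule.mul_mem_mul (Submodule.subset_span ⟨i, rfl⟩) ih

/-- The formal power series `∑ₙ ∑_{i₁, …, iₙ} c(i₁, …, iₙ) x_{i₁} ⋯ x_{iₙ}`. -/
def GCSeries.ofCoeff [Fintype ι] (deg : ι → ℤ) (c : List ι → k) : GCSeries k deg :=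
  ⟨PowerSeries.mk fun n => ∑ I : Fin n → ι, c (List.ofFn I) • GCPoly.mon k deg (List.ofFn I), by
    intro n
    rw [PowerSeries.coeff_mk]
    refine Submodule.sum_mem _ fun I _ => Submodule.smul_mem _ _ ?_
    have := GCPoly.mon_mem (k := k) (deg := deg) (List.ofFn I)
    rwa [List.length_ofFn] at this⟩

/-! ### Potentials and changes of coordinates -/

/-- A homogeneous basis of the graded vector space `(A, 𝒜)`. -/
structure HomogBasis (𝒜 : ℤ → Submodule k A) (ι : Type*) where
  basis : Module.Basis ι k A
  deg : ι → ℤ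
  mem : ∀ i, basis i ∈ 𝒜 (deg i)

/-- The basis element `e_i` as a homogeneous element. -/
def HomogBasis.elt {𝒜 : ℤ → Submodule k A} (e : HomogBasis 𝒜 ι) (i : ι) : Homog 𝒜 :=
  ⟨e.deg i, ⟨e.basis i, e.mem i⟩⟩

/-- The degree `-|e_i|'` of the formal variable `x_i` attached to the basis element `e_i`. -/
def HomogBasis.varDeg {𝒜 : ℤ → Submodule k A} (e : HomogBasis 𝒜 ι) (i : ι) : ℤ := -sdeg (e.elt i)

/-- The ring of formal power series in the variables `x_i` attached to the basis `e_i`. -/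
abbrev HomogBasis.Series {𝒜 : ℤ → Submodule k A} (e : HomogBasis 𝒜 ι) : Type _ :=
  GCSeries k e.varDeg

/-- For a word `a₁, …, a_{N+1}` the number
`1/(N+1) ∑_{p+k+q=N} ± φ_{p,q}(a₁, …, a_p, m_k(a_{p+1}, …, a_{p+k}), …, a_N)(a_{N+1})`;
the sign is that of moving `m_k` past `a₁, …, a_p`. -/
def potCoeff {𝒜 : ℤ → Submodule k A} (M : AInfAlgebra 𝒜) (φ : PreBimod k A)
    (l : List (Homog 𝒜)) : k :=
  match l.getLast? with
  | none => 0
  | some y => (l.length : k)⁻¹ * sumSplit₃ l.dropLast fun u v w =>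
      sgn k (wdeg u) * φ (word u) (M.m (word v)) (word w) y.2

/-- The potential `Φ^A(x) = ∑_N ∑_{p+q+k=N} 1/(N+1) ⟨x,…,x, m_k(x,…,x), x,…,x | x⟩_{p,q}`, with
`x = ∑ e_i x_i`, expanded in the variables `x_i`. -/
def potential [Fintype ι] {𝒜 : ℤ → Submodule k A} (M : AInfAlgebra 𝒜) (φ : PreBimod k A)
    (e : HomogBasis 𝒜 ι) : e.Series :=
  GCSeries.ofCoeff e.varDeg fun I => potCoeff M φ (I.map e.elt)

/-- For a word `a₁, …, a_{k+1}` the number `1/(k+1) ⟨m_k(a₁, …, a_k), a_{k+1}⟩`. -/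
def cyclicPotCoeff {𝒜 : ℤ → Submodule k A} {M : AInfAlgebra 𝒜} (c : CyclicInnerProduct M)
    (l : List (Homog 𝒜)) : k :=
  match l.getLast? with
  | none => 0
  | some y => (l.length : k)⁻¹ * c.form (M.m (word l.dropLast)) y.2

/-- The potential `Φ^B(y) = ∑_k 1/(k+1) ⟨m_k(y,…,y), y⟩` of a cyclic A∞-algebra, with
`y = ∑ f_j y_j`, expanded in the variables `y_j`. -/
def cyclicPotential [Fintype ι] {𝒜 : ℤ → Submodule k A} {M : AInfAlgebra 𝒜}
    (c : CyclicInnerProduct M) (e : HomogBasis 𝒜 ι) : e.Series :=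
  GCSeries.ofCoeff e.varDeg fun I => cyclicPotCoeff c (I.map e.elt)

/-! The defining relations are respected by the substitution. -/

theorem sgn_add (a b : ℤ) : sgn k (a + b) = sgn k a * sgn k b :=
  zpow_add₀ (neg_ne_zero.2 one_ne_zero) a b

theorem GCPoly.var_mul_var (i j : ι) :
    GCPoly.var k deg i * GCPoly.var k deg j =
      sgn k (deg i * deg j) • (GCPoly.var k deg j * GCPoly.var k deg i) := by
  have := RingQuot.mkAlgHom_rel k (GCRel.comm (k := k) (deg := deg) i j)
  rw [map_mul, map_smul, map_mul] at this
  exact this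

theorem GCPoly.var_mul_mon (i : ι) (J : List ι) :
    GCPoly.var k deg i * GCPoly.mon k deg J =
      sgn k (deg i * (J.map deg).sum) • (GCPoly.mon k deg J * GCPoly.var k deg i) := by
  induction J with
  | nil => simp [GCPoly.mon, sgn]
  | cons j J ih =>
    have h : GCPoly.mon k deg (j :: J) = GCPoly.var k deg j * GCPoly.mon k deg J := by
      simp [GCPoly.mon]
    rw [h, ← mul_assoc, GCPoly.var_mul_var, smul_mul_assoc, mul_assoc, ih, mul_smul_comm, smul_smul,
      ← sgn_add, ← mul_assoc, List.map_cons, List.sum_cons, mul_add]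

theorem GCPoly.mon_mul_mon (I J : List ι) :
    GCPoly.mon k deg I * GCPoly.mon k deg J =
      sgn k ((I.map deg).sum * (J.map deg).sum) • (GCPoly.mon k deg J * GCPoly.mon k deg I) := by
  induction I with
  | nil => simp [GCPoly.mon, sgn]
  | cons i I ih =>
    have h : GCPoly.mon k deg (i :: I) = GCPoly.var k deg i * GCPoly.mon k deg I := by
      simp [GCPoly.mon]
    rw [h, mul_assoc, ih, mul_smul_comm, ← mul_assoc, GCPoly.var_mul_mon, smul_mul_assoc, smul_smul,
      ← sgn_add, mul_assoc, List.map_cons, List.sum_cons]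
    congr 2
    ring

theorem HomogBasis.repr_eq_zero {𝒜 : ℤ → Submodule k A} [DirectSum.Decomposition 𝒜]
    (e : HomogBasis 𝒜 ι) {n : ℤ} {a : A} (ha : a ∈ 𝒜 n) {i : ι} (hi : e.deg i ≠ n) :
    e.basis.repr a i = 0 := by
  classical
  let P : A →ₗ[k] A := (𝒜 n).subtype ∘ₗ DirectSum.component k ℤ (fun n => 𝒜 n) n ∘ₗ
    (DirectSum.decomposeLinearEquiv 𝒜).toLinearMap
  have hP : ∀ x, P x = (DirectSum.decompose 𝒜 x n : A) := fun x => rfl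
  have h0 : e.basis.coord i ∘ₗ P = 0 := by
    refine e.basis.ext fun j => ?_
    rw [LinearMap.comp_apply, hP]
    by_cases hj : e.deg j = n
    · have hm : e.basis j ∈ 𝒜 n := hj ▸ e.mem j
      rw [DirectSum.decompose_of_mem_same _ hm]
      have hij : j ≠ i := fun h => hi (h ▸ hj)
      simp [hij]
    · rw [DirectSum.decompose_of_mem_ne _ (e.mem j) hj]
      simp
  have h1 := LinearMap.congr_fun h0 a
  rw [LinearMap.comp_apply, hP, DirectSum.decompose_of_mem_same _ ha] at h1
  simpa using h1

theorem HomogBasis.sum_varDeg {𝒜 : ℤ → Submodule k A} (e : HomogBasis 𝒜 ι) (J : List ι) :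
    (J.map e.varDeg).sum = - wdeg (J.map e.elt) := by
  induction J with
  | nil => simp [wdeg]
  | cons j J ih =>
    simp only [wdeg, List.map_cons, List.sum_cons] at ih ⊢
    rw [ih, HomogBasis.varDeg]
    ring

section Pullback

variable {𝒜 : ℤ → Submodule k A} {ℬ : ℤ → Submodule k B} [DirectSum.Decomposition 𝒜]
  {M : AInfAlgebra 𝒜} {N : AInfAlgebra ℬ} [Fintype κ]

/-- The series `∑_n ∑_{j₁, …, jₙ} h^i_{j₁ ⋯ jₙ} y_{j₁} ⋯ y_{jₙ}`, where
`h_n(f_{j₁}, …, f_{jₙ}) = ∑_i h^i_{j₁ ⋯ jₙ} e_i`, which is substituted for `x_i`. -/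
def coordSeries (F : AInfHom N M) (e : HomogBasis 𝒜 ι) (f : HomogBasis ℬ κ) (i : ι) : f.Series :=
  GCSeries.ofCoeff f.varDeg fun J => e.basis.repr (F.h (word (J.map f.elt))) i

theorem coordSeries_mul (F : AInfHom N M) (e : HomogBasis 𝒜 ι) (f : HomogBasis ℬ κ) (i j : ι) :
    coordSeries F e f i * coordSeries F e f j =
      sgn k (e.varDeg i * e.varDeg j) • (coordSeries F e f j * coordSeries F e f i) := by
  have key : ∀ (i : ι) (J : List κ), e.basis.repr (F.h (word (J.map f.elt))) i ≠ 0 →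
      (J.map f.varDeg).sum = e.varDeg i := by
    intro i J hJ
    have h := mt (e.repr_eq_zero (F.h_degree (J.map f.elt)) (i := i)) hJ
    rw [not_not] at h
    have h' : sdeg (e.elt i) = e.deg i - 1 := rfl
    rw [f.sum_varDeg, HomogBasis.varDeg, h', h]
    ring
  apply Subtype.ext
  refine PowerSeries.ext fun n => ?_
  simp only [MulMemClass.coe_mul, SetLike.val_smul, PowerSeries.coeff_smul, PowerSeries.coeff_mul]
  rw [← Finset.Nat.sum_antidiagonal_swap, Finset.smul_sum]
  refine Finset.sum_congr rfl fun p _ => ?_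
  simp only [coordSeries, GCSeries.ofCoeff, PowerSeries.coeff_mk, Prod.fst_swap, Prod.snd_swap]
  rw [Finset.sum_mul_sum, Finset.sum_mul_sum, Finset.sum_comm, Finset.smul_sum]
  refine Finset.sum_congr rfl fun J _ => ?_
  rw [Finset.smul_sum]
  refine Finset.sum_congr rfl fun I _ => ?_
  by_cases hI : e.basis.repr (F.h (word ((List.ofFn I).map f.elt))) i = 0
  · simp only [hI, zero_smul, zero_mul, mul_zero, smul_zero]
  by_cases hJ : e.basis.repr (F.h (word ((List.ofFn J).map f.elt))) j = 0
  · simp only [hJ, zero_smul, zero_mul, mul_zero, smul_zero]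
  rw [smul_mul_smul_comm, smul_mul_smul_comm, GCPoly.mon_mul_mon, key i _ hI, key j _ hJ,
    smul_comm, mul_comm (e.basis.repr _ i)]

/-- The change of coordinates `x_i ↦ ∑ h^i_{j₁ ⋯ jₙ} y_{j₁} ⋯ y_{jₙ}` on polynomials. -/
def coordHom (F : AInfHom N M) (e : HomogBasis 𝒜 ι) (f : HomogBasis ℬ κ) :
    GCPoly k e.varDeg →ₐ[k] f.Series :=
  RingQuot.liftAlgHom k ⟨FreeAlgebra.lift k (coordSeries F e f), by
    rintro _ _ ⟨i, j⟩
    simp only [map_mul, map_smul, FreeAlgebra.lift_ι_apply]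
    exact coordSeries_mul F e f i j⟩

theorem coordHom_var (F : AInfHom N M) (e : HomogBasis 𝒜 ι) (f : HomogBasis ℬ κ) (i : ι) :
    coordHom F e f (GCPoly.var k e.varDeg i) = coordSeries F e f i := by
  simp [coordHom, GCPoly.var]

/-- The pull-back `h^* Φ` of a power series under the change of coordinates
`x_i ↦ ∑ h^i_{j₁ ⋯ jₙ} y_{j₁} ⋯ y_{jₙ}`. If `Φ = ∑_m Φ_m`, with `Φ_m` homogeneous of polynomial
degree `m`, then `h^* Φ = ∑_m h^* Φ_m`; as `h^*` does not lower the polynomial degree, only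
`m ≤ n` contribute to the part of degree `n`. -/
def pullback (F : AInfHom N M) (e : HomogBasis 𝒜 ι) (f : HomogBasis ℬ κ) (Φ : e.Series) :
    f.Series :=
  ⟨PowerSeries.mk fun n => ∑ m ∈ Finset.range (n + 1),
      PowerSeries.coeff n (coordHom F e f (PowerSeries.coeff m Φ.1)).1, by
    intro n
    rw [PowerSeries.coeff_mk]
    exact Submodule.sum_mem _ fun m _ => (coordHom F e f _).2 n⟩

end Pullback

end Graded

end HCyc

end

open HCyc

noncomputable section

namespace HCyc

/-! ### Combinatorics of splitting words: deconcatenation, blocks, and sums over words. -/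

section Words

variable {α β M : Type*} [AddCommMonoid M]

/-! Regard φ as a closed two-form Ω on a formal graded manifold and the operations m as a vector
field Q. The one-form ι_Q Ω is `contraction`. The bimodule relation, skew symmetry and closedness
together make it closed, which on words means invariance under cyclic rotation up to the Koszul sign
(`contraction_rotate`, `contractionCyc_rotate`). On a word of length N+1 the coefficient of Φ^A is
the value of ι_Q Ω divided by N+1 (`potCoeff_eq`), so Φ^A is the primitive that Euler's formula
assigns to a closed one-form.

Since h intertwines the two vector fields, h^* carries ι_Q Ω to the contraction of h^*Ω
(`sumSplit₃_pullBimod`), and h^*Ω is the constant form ψ. Thus Φ^B is the Euler primitive of the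
pulled-back one-form, and it remains to see that taking this primitive commutes with the non-linear
substitution h^*.

This is a double count in each polynomial degree n. By `coeff_coordHom_poly`, h^*Φ^A is a sum over
decompositions of words into m+1 blocks, with weight 1/(m+1). In Φ^B a decomposition comes with a
marked letter and weight 1/n; rotating the marked block to the end, it is counted as often as that
block has letters (`poly_cyclicPotCoeff`). The lengths of all m+1 blocks add up to n, and by cyclic
symmetry each block contributes the same, so n times the plain sum is m+1 times the sum weighted by
the length of the last block (`poly_sumBlocks_weight`, `poly_potCoeff`). The rotations are made on
polynomials, not word by word: graded commutativity of the monomials absorbs the Koszul signs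
(`poly_rotate`). -/

theorem sumSplit₂_nil (f : List α → List α → M) : sumSplit₂ [] f = f [] [] := by
  simp [sumSplit₂]

theorem sumSplit₂_cons (a : α) (l : List α) (f : List α → List α → M) :
    sumSplit₂ (a :: l) f = f [] (a :: l) + sumSplit₂ l fun u v => f (a :: u) v := by
  simp only [sumSplit₂, List.length_cons]
  rw [Finset.sum_range_succ', add_comm]
  simp

theorem sumSplit₂_concat (l : List α) (a : α) (f : List α → List α → M) :
    sumSplit₂ (l ++ [a]) f = sumSplit₂ l (fun u v => f u (v ++ [a])) + f (l ++ [a]) [] := by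
  induction l generalizing f with
  | nil => simp [sumSplit₂_cons, sumSplit₂_nil]
  | cons b l ih =>
    rw [List.cons_append, sumSplit₂_cons, ih, sumSplit₂_cons, add_assoc]
    rfl

theorem sumSplit₂_congr {l : List α} {f g : List α → List α → M}
    (h : ∀ u v, u ++ v = l → f u v = g u v) : sumSplit₂ l f = sumSplit₂ l g :=
  Finset.sum_congr rfl fun i _ => h _ _ (List.take_append_drop i l)

theorem sumSplit₃_congr {l : List α} {f g : List α → List α → List α → M}
    (h : ∀ u v w, u ++ (v ++ w) = l → f u v w = g u v w) : sumSplit₃ l f = sumSplit₃ l g :=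
  sumSplit₂_congr fun u r hr => sumSplit₂_congr fun v w hw => h u v w (by rw [hw, hr])

theorem sumSplit₂_zero (l : List α) : sumSplit₂ l (fun _ _ => (0 : M)) = 0 := by
  simp [sumSplit₂]

theorem sumSplit₂_add (l : List α) (f g : List α → List α → M) :
    sumSplit₂ l (fun u v => f u v + g u v) = sumSplit₂ l f + sumSplit₂ l g := by
  simp [sumSplit₂, Finset.sum_add_distrib]

theorem sumSplit₂_sum {σ : Type*} (s : Finset σ) (l : List α) (f : σ → List α → List α → M) :
    sumSplit₂ l (fun u v => ∑ i ∈ s, f i u v) = ∑ i ∈ s, sumSplit₂ l (f i) := by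
  simp only [sumSplit₂]
  rw [Finset.sum_comm]

theorem map_sumSplit₂ {N G : Type*} [AddCommMonoid N] [FunLike G M N] [AddMonoidHomClass G M N]
    (g : G) (l : List α) (f : List α → List α → M) :
    g (sumSplit₂ l f) = sumSplit₂ l fun u v => g (f u v) := by
  simp [sumSplit₂]

theorem mul_sumSplit₂ {R : Type*} [NonUnitalNonAssocSemiring R] (c : R) (l : List α)
    (f : List α → List α → R) :
    c * sumSplit₂ l f = sumSplit₂ l fun u v => c * f u v := by
  simp [sumSplit₂, Finset.mul_sum]

theorem sumSplit₃_add (l : List α) (f g : List α → List α → List α → M) :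
    sumSplit₃ l (fun u v w => f u v w + g u v w) = sumSplit₃ l f + sumSplit₃ l g := by
  simp only [sumSplit₃, sumSplit₂_add]

theorem mul_sumSplit₃ {R : Type*} [NonUnitalNonAssocSemiring R] (c : R) (l : List α)
    (f : List α → List α → List α → R) :
    c * sumSplit₃ l f = sumSplit₃ l fun u v w => c * f u v w := by
  simp only [sumSplit₃, mul_sumSplit₂]

theorem sumSplit₂_neg {G : Type*} [AddCommGroup G] (l : List α) (f : List α → List α → G) :
    sumSplit₂ l (fun u v => - f u v) = - sumSplit₂ l f := by
  simp [sumSplit₂]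

theorem sumSplit₂_comm (l : List α) (l' : List β) (f : List α → List α → List β → List β → M) :
    sumSplit₂ l (fun u v => sumSplit₂ l' fun u' v' => f u v u' v') =
      sumSplit₂ l' fun u' v' => sumSplit₂ l fun u v => f u v u' v' := by
  simp only [sumSplit₂]
  rw [Finset.sum_comm]

/-- Coassociativity of deconcatenation, the source of all later regroupings. -/
theorem sumSplit₂_assoc (l : List α) (f : List α → List α → List α → M) :
    sumSplit₂ l (fun r w => sumSplit₂ r fun u v => f u v w) =
      sumSplit₂ l fun u r => sumSplit₂ r fun v w => f u v w := by
  induction l generalizing f with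
  | nil => simp [sumSplit₂_nil]
  | cons a l ih =>
    simp only [sumSplit₂_cons, sumSplit₂_nil, sumSplit₂_add, ih]
    abel

theorem sumSplit₂_map (g : α → β) (l : List α) (f : List β → List β → M) :
    sumSplit₂ (l.map g) f = sumSplit₂ l fun u v => f (u.map g) (v.map g) := by
  simp [sumSplit₂, List.map_take, List.map_drop]

theorem sumSplit₃_map (g : α → β) (l : List α) (f : List β → List β → List β → M) :
    sumSplit₃ (l.map g) f = sumSplit₃ l fun u v w => f (u.map g) (v.map g) (w.map g) := by
  simp [sumSplit₃, sumSplit₂_map]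

theorem sumSplit₂_eq_left {l : List α} {f : List α → List α → M}
    (h : ∀ a u v, f (a :: u) v = 0) : sumSplit₂ l f = f [] l := by
  cases l with
  | nil => exact sumSplit₂_nil f
  | cons a l => simp [sumSplit₂_cons, h, sumSplit₂_zero]

theorem sumSplit₂_eq_right {l : List α} {f : List α → List α → M}
    (h : ∀ u a v, f u (a :: v) = 0) : sumSplit₂ l f = f l [] := by
  induction l generalizing f with
  | nil => exact sumSplit₂_nil f
  | cons a l ih => rw [sumSplit₂_cons, h, zero_add, ih fun u a v => h _ _ _]

/-- The number of ways to write `l = u ++ v` with `u` non-empty is the length of `l`. -/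
theorem sumSplit₂_ne_nil (l : List α) (x : M) :
    sumSplit₂ l (fun u _ => if u = [] then 0 else x) = l.length • x := by
  cases l with
  | nil => simp [sumSplit₂_nil]
  | cons a l =>
    rw [sumSplit₂_cons]
    simp [sumSplit₂]

/-! ### Decompositions of a word into blocks -/

/-- Sum of `F [l₁, …, lₙ]` over all ways to write `l = l₁ ++ ⋯ ++ lₙ`, with possibly empty
blocks. -/
def sumBlocks : ℕ → List α → (List (List α) → M) → M
  | 0, [], F => F []
  | 0, _ :: _, _ => 0
  | n + 1, l, F => sumSplit₂ l fun u v => sumBlocks n v fun L => F (u :: L)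

theorem sumBlocks_succ (n : ℕ) (l : List α) (F : List (List α) → M) :
    sumBlocks (n + 1) l F = sumSplit₂ l fun u v => sumBlocks n v fun L => F (u :: L) := by
  simp [sumBlocks]

theorem sumBlocks_congr {n : ℕ} {l : List α} {F G : List (List α) → M}
    (h : ∀ L, L.length = n → L.flatten = l → F L = G L) : sumBlocks n l F = sumBlocks n l G := by
  induction n generalizing l F G with
  | zero =>
    cases l with
    | nil => simpa [sumBlocks] using h [] rfl rfl
    | cons a l => simp [sumBlocks]
  | succ n ih =>
    rw [sumBlocks_succ, sumBlocks_succ]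
    refine sumSplit₂_congr fun u v huv => ih fun L hL hv => h _ ?_ ?_
    · simp [hL]
    · rw [List.flatten_cons, hv, huv]

theorem sumBlocks_zero (n : ℕ) (l : List α) : sumBlocks n l (fun _ => (0 : M)) = 0 := by
  induction n generalizing l with
  | zero => cases l <;> simp [sumBlocks]
  | succ n ih => simp [sumBlocks_succ, ih, sumSplit₂_zero]

theorem map_sumBlocks {N G : Type*} [AddCommMonoid N] [FunLike G M N] [AddMonoidHomClass G M N]
    (g : G) (n : ℕ) (l : List α) (F : List (List α) → M) :
    g (sumBlocks n l F) = sumBlocks n l fun L => g (F L) := by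
  induction n generalizing l F with
  | zero => cases l <;> simp [sumBlocks]
  | succ n ih => simp only [sumBlocks_succ, map_sumSplit₂, ih]

theorem mul_sumBlocks {R : Type*} [NonUnitalNonAssocSemiring R] (c : R) (n : ℕ) (l : List α)
    (F : List (List α) → R) : c * sumBlocks n l F = sumBlocks n l fun L => c * F L :=
  map_sumBlocks (AddMonoidHom.mulLeft c) n l F

theorem sumBlocks_sumSplit₂ (n : ℕ) (l : List α) (l' : List β)
    (F : List (List α) → List β → List β → M) :
    sumBlocks n l (fun L => sumSplit₂ l' (F L)) =
      sumSplit₂ l' fun u v => sumBlocks n l fun L => F L u v := by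
  induction n generalizing l F with
  | zero => cases l <;> simp [sumBlocks, sumSplit₂_zero]
  | succ n ih => simp only [sumBlocks_succ, ih, sumSplit₂_comm l l']

theorem sumBlocks_comm (m n : ℕ) (l : List α) (l' : List β)
    (F : List (List α) → List (List β) → M) :
    sumBlocks m l (fun L => sumBlocks n l' fun L' => F L L') =
      sumBlocks n l' fun L' => sumBlocks m l fun L => F L L' := by
  induction n generalizing l' F with
  | zero => cases l' <;> simp [sumBlocks, sumBlocks_zero]
  | succ n ih => simp only [sumBlocks_succ, ← ih, sumBlocks_sumSplit₂]

theorem sumBlocks_sum {σ : Type*} (s : Finset σ) (n : ℕ) (l : List α)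
    (F : σ → List (List α) → M) :
    sumBlocks n l (fun L => ∑ i ∈ s, F i L) = ∑ i ∈ s, sumBlocks n l (F i) := by
  induction n generalizing l F with
  | zero => cases l <;> simp [sumBlocks]
  | succ n ih => simp only [sumBlocks_succ, ih, sumSplit₂_sum]

theorem sumBlocks_add (m n : ℕ) (l : List α) (F : List (List α) → M) :
    sumBlocks (m + n) l F =
      sumSplit₂ l fun u v => sumBlocks m u fun L => sumBlocks n v fun L' => F (L ++ L') := by
  induction m generalizing l F with
  | zero =>
    rw [sumSplit₂_eq_left fun a u v => by simp [sumBlocks]]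
    simp [sumBlocks]
  | succ m ih =>
    rw [add_right_comm, sumBlocks_succ]
    simp only [ih, sumBlocks_succ, List.cons_append]
    exact (sumSplit₂_assoc l _).symm

theorem sumBlocks_one (l : List α) (F : List (List α) → M) : sumBlocks 1 l F = F [l] := by
  rw [sumBlocks_succ, sumSplit₂_eq_right fun u a v => by simp [sumBlocks]]
  simp [sumBlocks]

theorem sumBlocks_succ' (n : ℕ) (l : List α) (F : List (List α) → M) :
    sumBlocks (n + 1) l F = sumSplit₂ l fun u v => sumBlocks n u fun L => F (L ++ [v]) := by
  rw [sumBlocks_add]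
  simp only [sumBlocks_one]

/-- Splitting a decomposition into blocks at a block boundary. -/
theorem sumBlocks_split (n : ℕ) (l : List α) (f : List (List α) → List (List α) → M) :
    sumBlocks n l (fun L => sumSplit₂ L f) =
      ∑ p ∈ Finset.HasAntidiagonal.antidiagonal n, sumSplit₂ l fun u v =>
        sumBlocks p.1 u fun L => sumBlocks p.2 v fun L' => f L L' := by
  rw [Finset.Nat.sum_antidiagonal_eq_sum_range_succ_mk]
  have h1 : sumBlocks n l (fun L => sumSplit₂ L f) =
      sumBlocks n l (fun L => ∑ i ∈ Finset.range (n + 1), f (L.take i) (L.drop i)) :=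
    sumBlocks_congr fun L hL _ => by rw [sumSplit₂, hL]
  rw [h1, sumBlocks_sum]
  refine Finset.sum_congr rfl fun i hi => ?_
  have hin : i + (n - i) = n := by
    have := Finset.mem_range.1 hi
    omega
  conv_lhs => rw [← hin]
  rw [sumBlocks_add]
  refine sumSplit₂_congr fun u v _ => sumBlocks_congr fun L hL _ => sumBlocks_congr fun L' _ _ => ?_
  rw [← hL, List.take_left, List.drop_left]

/-- Pigeonhole: with more blocks than letters, some block is empty. -/
theorem sumBlocks_eq_zero {n : ℕ} {l : List α} {F : List (List α) → M} (hn : l.length < n)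
    (hF : ∀ L, [] ∈ L → F L = 0) : sumBlocks n l F = 0 := by
  rw [← sumBlocks_zero (M := M) n l]
  refine sumBlocks_congr fun L hL hl => hF L ?_
  by_contra h
  have : L.length ≤ L.flatten.length := by
    clear hL hl
    induction L with
    | nil => simp
    | cons u L ih =>
      simp only [List.mem_cons, not_or] at h
      have h1 : 0 < u.length := List.length_pos_iff.2 (Ne.symm h.1)
      have h2 := ih h.2
      simp only [List.length_cons, List.flatten_cons, List.length_append]
      omega
  rw [hl, hL] at this
  omega

/-- Sum of `F [l₁, …, lₙ]` over all `n` and all ways to write `l = l₁ ++ ⋯ ++ lₙ`, for `F`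
vanishing if there is an empty block. -/
def sumAllBlocks (l : List α) (F : List (List α) → M) : M :=
  ∑ n ∈ Finset.range (l.length + 1), sumBlocks n l F

theorem sumAllBlocks_eq {K : ℕ} {l : List α} {F : List (List α) → M} (hK : l.length < K)
    (hF : ∀ L, [] ∈ L → F L = 0) :
    sumAllBlocks l F = ∑ n ∈ Finset.range K, sumBlocks n l F := by
  refine Finset.sum_subset (Finset.range_mono hK) fun n _ hn => sumBlocks_eq_zero ?_ hF
  simpa using hn

theorem map_sumAllBlocks {N G : Type*} [AddCommMonoid N] [FunLike G M N] [AddMonoidHomClass G M N]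
    (g : G) (l : List α) (F : List (List α) → M) :
    g (sumAllBlocks l F) = sumAllBlocks l fun L => g (F L) := by
  simp only [sumAllBlocks, map_sum, map_sumBlocks]

theorem sumAllBlocks_congr {l : List α} {F G : List (List α) → M}
    (h : ∀ L, L.flatten = l → F L = G L) : sumAllBlocks l F = sumAllBlocks l G :=
  Finset.sum_congr rfl fun _ _ => sumBlocks_congr fun L _ hL => h L hL

/-- This is the compatibility of ĥ with deconcatenation. The two sides bound the number of blocks
differently (p + q by the length of l, against p and q by the lengths of u and v); the surplus terms
contain an empty block and vanish. -/
theorem sumAllBlocks_split (l : List α) (f : List (List α) → List (List α) → M)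
    (hf : ∀ L L', [] ∈ L → f L L' = 0) (hf' : ∀ L L', [] ∈ L' → f L L' = 0) :
    sumAllBlocks l (fun L => sumSplit₂ L f) =
      sumSplit₂ l fun u v => sumAllBlocks u fun L => sumAllBlocks v fun L' => f L L' := by
  have h0 : ∀ (u v : List α) (p q : ℕ), u.length < p ∨ v.length < q →
      sumBlocks p u (fun L => sumBlocks q v fun L' => f L L') = 0 := by
    rintro u v p q (h | h)
    · refine sumBlocks_eq_zero h fun L hL => ?_
      simp only [hf L _ hL, sumBlocks_zero]
    · have : ∀ L, (sumBlocks q v fun L' => f L L') = 0 := fun L => sumBlocks_eq_zero h (hf' L)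
      simp only [this, sumBlocks_zero]
  rw [sumAllBlocks]
  simp only [sumBlocks_split, ← sumSplit₂_sum]
  refine sumSplit₂_congr fun u v huv => ?_
  simp only [sumAllBlocks, sumBlocks_sum]
  rw [← Finset.sum_product', Finset.sum_sigma']
  -- Only the non-zero terms are matched, so the two index sets need not correspond.
  refine Finset.sum_bij_ne_zero (fun x _ _ => x.2) ?_ ?_ ?_ ?_
  · rintro ⟨n, p, q⟩ _ hne
    by_contra hx
    refine hne (h0 u v p q ?_)
    dsimp only at hx
    simp only [Finset.mem_product, Finset.mem_range] at hx
    omega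
  · rintro ⟨n, p⟩ hn _ ⟨n', p'⟩ hn' _ h
    simp only [Finset.mem_sigma, Finset.HasAntidiagonal.mem_antidiagonal] at hn hn'
    simp only at h
    subst h
    obtain rfl : n = n' := by rw [← hn.2, ← hn'.2]
    rfl
  · rintro ⟨p, q⟩ hpq hne
    refine ⟨⟨p + q, p, q⟩, ?_, hne, rfl⟩
    simp only [Finset.mem_product, Finset.mem_range] at hpq
    have := congrArg List.length huv
    rw [List.length_append] at this
    simp only [Finset.mem_sigma, Finset.mem_range, Finset.HasAntidiagonal.mem_antidiagonal, and_true]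
    omega
  · intros; rfl

/-! ### Sums over all words of a given length -/

/-- The sum of `G l` over all words `l` of length `n` in a finite alphabet. -/
def wordSum [Fintype α] (n : ℕ) (G : List α → M) : M := ∑ I : Fin n → α, G (List.ofFn I)

theorem wordSum_add [Fintype α] (m n : ℕ) (G : List α → M) :
    wordSum (m + n) G = wordSum m fun u => wordSum n fun v => G (u ++ v) := by
  simp only [wordSum]
  rw [← Finset.sum_product', Finset.univ_product_univ, ← (Fin.appendEquiv m n).sum_comp]
  refine Finset.sum_congr rfl fun I _ => ?_
  simp [Fin.appendEquiv, List.ofFn_fin_append]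

theorem wordSum_congr [Fintype α] {n : ℕ} {G G' : List α → M}
    (h : ∀ l, l.length = n → G l = G' l) : wordSum n G = wordSum n G' :=
  Finset.sum_congr rfl fun _ _ => h _ (List.length_ofFn)

theorem wordSum_succ [Fintype α] (n : ℕ) (G : List α → M) :
    wordSum (n + 1) G = ∑ a, wordSum n fun l => G (a :: l) := by
  rw [add_comm, wordSum_add]
  simp only [wordSum]
  rw [← (Equiv.funUnique (Fin 1) α).symm.sum_comp]
  simp

theorem wordSum_comm [Fintype α] [Fintype β] (m n : ℕ) (G : List α → List β → M) :
    (wordSum m fun u => wordSum n fun v => G u v) = wordSum n fun v => wordSum m fun u => G u v :=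
  Finset.sum_comm

theorem wordSum_sumSplit₂ [Fintype α] (n : ℕ) (f : List α → List α → M) :
    (wordSum n fun l => sumSplit₂ l f) =
      ∑ p ∈ Finset.HasAntidiagonal.antidiagonal n, wordSum p.1 fun u => wordSum p.2 fun v => f u v := by
  have h1 : (wordSum n fun l => sumSplit₂ l f) =
      wordSum n fun l => ∑ i ∈ Finset.range (n + 1), f (l.take i) (l.drop i) :=
    wordSum_congr fun l hl => by rw [sumSplit₂, hl]
  rw [h1, Finset.Nat.sum_antidiagonal_eq_sum_range_succ_mk, wordSum, Finset.sum_comm]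
  refine Finset.sum_congr rfl fun i hi => ?_
  have hin : i + (n - i) = n := by
    have := Finset.mem_range.1 hi
    omega
  change wordSum n (fun l => f (l.take i) (l.drop i)) = _
  conv_lhs => rw [← hin]
  rw [wordSum_add]
  refine wordSum_congr fun u hu => wordSum_congr fun v _ => ?_
  rw [← hu, List.take_left, List.drop_left]

/-- All words of length n are summed, so `u ++ v` may be replaced by `v ++ u`; the summand sees only
the two pieces. -/
theorem wordSum_sumSplit₂_swap [Fintype α] (n : ℕ) (f : List α → List α → M) :
    (wordSum n fun l => sumSplit₂ l f) = wordSum n fun l => sumSplit₂ l fun u v => f v u := by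
  rw [wordSum_sumSplit₂, wordSum_sumSplit₂, ← Finset.Nat.sum_antidiagonal_swap]
  exact Finset.sum_congr rfl fun p _ => wordSum_comm _ _ _

end Words

section Graded

variable {k : Type*} [Field k] {A : Type*} [AddCommGroup A] [Module k A]
  {B : Type*} [AddCommGroup B] [Module k B] {𝒜 : ℤ → Submodule k A} {ℬ : ℤ → Submodule k B}

/-! ### Signs and degrees -/

theorem sgn_eq_of_even {m n : ℤ} (h : Even (m - n)) : sgn k m = sgn k n := by
  have : m = n + (m - n) := by ring
  rw [this, sgn_add, sgn, sgn, h.neg_one_zpow, mul_one]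

theorem sgn_mul_self (n : ℤ) : sgn k n * sgn k n = 1 := by
  rw [← sgn_add, sgn, Even.neg_one_zpow ⟨n, rfl⟩]

theorem sgn_zero : sgn k 0 = 1 := by simp [sgn]

theorem wdeg_nil : wdeg ([] : List (Homog 𝒜)) = 0 := rfl

theorem wdeg_cons (a : Homog 𝒜) (l : List (Homog 𝒜)) : wdeg (a :: l) = sdeg a + wdeg l := by
  simp [wdeg]

theorem wdeg_append (l l' : List (Homog 𝒜)) : wdeg (l ++ l') = wdeg l + wdeg l' := by
  simp [wdeg]

theorem word_nil : word ([] : List (Homog 𝒜)) = 1 := rfl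

theorem word_cons (a : Homog 𝒜) (l : List (Homog 𝒜)) :
    word (a :: l) = TensorAlgebra.ι k (a.2 : A) * word l := by
  simp [word]

theorem word_append (l l' : List (Homog 𝒜)) : word (l ++ l') = word l * word l' := by
  simp [word]

/-- `m(l)` as a homogeneous element. -/
def AInfAlgebra.mHomog (M : AInfAlgebra 𝒜) (l : List (Homog 𝒜)) : Homog 𝒜 :=
  ⟨wdeg l + 2, M.m (word l), M.m_degree l⟩

theorem AInfAlgebra.sdeg_mHomog (M : AInfAlgebra 𝒜) (l : List (Homog 𝒜)) :
    sdeg (M.mHomog l) = wdeg l + 1 := by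
  simp only [sdeg, AInfAlgebra.mHomog]
  ring

/-- `h(l)` as a homogeneous element. -/
def AInfHom.hHomog {M : AInfAlgebra 𝒜} {N : AInfAlgebra ℬ} (F : AInfHom M N)
    (l : List (Homog 𝒜)) : Homog ℬ :=
  ⟨wdeg l + 1, F.h (word l), F.h_degree l⟩

theorem AInfHom.sdeg_hHomog {M : AInfAlgebra 𝒜} {N : AInfAlgebra ℬ} (F : AInfHom M N)
    (l : List (Homog 𝒜)) : sdeg (F.hHomog l) = wdeg l := by
  simp only [sdeg, AInfHom.hHomog]
  ring

/-- As h has shifted degree 0, applying it to blocks changes no Koszul sign. -/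
theorem AInfHom.wdeg_map_hHomog {M : AInfAlgebra 𝒜} {N : AInfAlgebra ℬ} (F : AInfHom M N)
    (L : List (List (Homog 𝒜))) : wdeg (L.map F.hHomog) = wdeg L.flatten := by
  induction L with
  | nil => rfl
  | cons l L ih => rw [List.map_cons, wdeg_cons, ih, F.sdeg_hHomog, List.flatten_cons, wdeg_append]

theorem AInfHom.word_map_hHomog_eq_zero {M : AInfAlgebra 𝒜} {N : AInfAlgebra ℬ} (F : AInfHom M N)
    {L : List (List (Homog 𝒜))} (hL : [] ∈ L) : word (L.map F.hHomog) = 0 := by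
  induction L with
  | nil => simp at hL
  | cons l L ih =>
    rw [List.map_cons, word_cons]
    rcases List.mem_cons.1 hL with h | h
    · subst h
      simp [AInfHom.hHomog, word_nil, F.h_zero]
    · rw [ih h, mul_zero]

theorem AInfHom.blocks_eq {M : AInfAlgebra 𝒜} {N : AInfAlgebra ℬ} (F : AInfHom M N) (n : ℕ)
    (l : List (Homog 𝒜)) :
    blocks F.h n l = sumBlocks n l fun L => word (L.map F.hHomog) := by
  induction n generalizing l with
  | zero => cases l <;> simp [blocks, sumBlocks, word_nil]
  | succ n ih =>
    simp only [blocks, sumBlocks_succ, ih]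
    refine sumSplit₂_congr fun u v _ => ?_
    simp only [List.map_cons, word_cons]
    exact map_sumBlocks (LinearMap.mulLeft k (TensorAlgebra.ι k (F.h (word u)))) n v _

theorem AInfHom.hatMap_eq {M : AInfAlgebra 𝒜} {N : AInfAlgebra ℬ} (F : AInfHom M N)
    (l : List (Homog 𝒜)) :
    hatMap F.h l = sumAllBlocks l fun L => word (L.map F.hHomog) := by
  simp only [hatMap, sumAllBlocks, F.blocks_eq]

/-! ### The one-form `ι_Q Ω` -/

/-- The contraction of the two-form `φ` with the vector field `m`:
`(a; y) ↦ ∑ ± φ(u, m(v), w)(y)`, the sum being over `a = u ++ v ++ w`. -/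
def contraction (M : AInfAlgebra 𝒜) (φ : PreBimod k A) (a : List (Homog 𝒜)) (y : Homog 𝒜) : k :=
  sumSplit₃ a fun u v w => sgn k (wdeg u) * φ (word u) (M.m (word v)) (word w) y.2

/-- The first letter lies inside m or in front of it; it can come after m only if m has no inputs,
and m₀ = 0. -/
theorem contraction_cons (M : AInfAlgebra 𝒜) (φ : PreBimod k A) (x : Homog 𝒜)
    (l : List (Homog 𝒜)) (y : Homog 𝒜) :
    contraction M φ (x :: l) y =
      sumSplit₂ l (fun v w => φ 1 (M.m (word (x :: v))) (word w) y.2) +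
      sumSplit₃ l fun u v w =>
        sgn k (sdeg x + wdeg u) * φ (word (x :: u)) (M.m (word v)) (word w) y.2 := by
  simp [contraction, sumSplit₃, sumSplit₂_cons, word_nil, wdeg_nil, M.m_zero, wdeg_cons, sgn_zero]

theorem contraction_concat (M : AInfAlgebra 𝒜) (φ : PreBimod k A) (x : Homog 𝒜)
    (l : List (Homog 𝒜)) (y : Homog 𝒜) :
    contraction M φ (l ++ [x]) y =
      sumSplit₂ l (fun u v => sgn k (wdeg u) * φ (word u) (M.m (word (v ++ [x]))) 1 y.2) +
      sumSplit₃ l fun u v w =>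
        sgn k (wdeg u) * φ (word u) (M.m (word v)) (word (w ++ [x])) y.2 := by
  simp only [contraction, sumSplit₃, sumSplit₂_concat, sumSplit₂_nil, word_nil, M.m_zero,
    sumSplit₂_add, map_zero, LinearMap.zero_apply, mul_zero, add_zero]
  rw [add_comm]

/-- The one-form `ι_Q Ω` is closed, i.e. invariant under cyclic rotations. -/
theorem contraction_rotate {M : AInfAlgebra 𝒜} {φ : PreBimod k A}
    (hφ : IsStrongHomotopyInnerProduct M φ) (x : Homog 𝒜) (l : List (Homog 𝒜)) (y : Homog 𝒜) :
    contraction M φ (x :: l) y =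
      sgn k (sdeg x * (wdeg l + sdeg y)) * contraction M φ (l ++ [y]) x := by
  -- With empty left word the bimodule relation keeps three sums: m containing x, m inside l, and m
  -- containing y. The first occurs in the contraction of `x :: l`; `h1` identifies the third with
  -- terms of the rotated contraction, and `h2` treats the rest.
  have hb := hφ.bimodule [] l x y
  simp only [sumSplit₃, sumSplit₂_nil, wdeg_nil, word_nil, M.m_zero, sgn_zero, map_zero, one_mul,
    mul_one, zero_mul, LinearMap.zero_apply, add_zero, zero_add, List.nil_append] at hb
  have h1 : (sumSplit₂ l fun u v => sgn k (sdeg x * (wdeg l + sdeg y)) *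
        (sgn k (wdeg u) * φ (word u) (M.m (word (v ++ [y]))) 1 x.2)) =
      - sumSplit₂ l fun b₁ b₂ => sgn k (sdeg x + wdeg b₁) *
        φ 1 x.2 (word b₁) (M.m (word (b₂ ++ [y]))) := by
    rw [← sumSplit₂_neg]
    refine sumSplit₂_congr fun u v huv => ?_
    have hs := hφ.skew u [] (M.mHomog (v ++ [y])) x
    have hd : sgn k (sdeg x + wdeg u) = sgn k (sdeg x * (wdeg l + sdeg y)) * sgn k (wdeg u) *
        sgn k ((wdeg u + sdeg (M.mHomog (v ++ [y]))) * (wdeg ([] : List (Homog 𝒜)) + sdeg x)) := by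
      rw [← sgn_add, ← sgn_add, M.sdeg_mHomog, ← huv]
      refine sgn_eq_of_even ⟨-(sdeg x * (wdeg u + wdeg v + sdeg y)), ?_⟩
      simp only [wdeg_append, wdeg_cons, wdeg_nil]
      ring
    rw [hd]
    simp only [AInfAlgebra.mHomog, word_nil] at hs ⊢
    rw [hs]
    ring
  have h2 : (sumSplit₃ l fun u v w =>
        sgn k (sdeg x + wdeg u) * φ (word (x :: u)) (M.m (word v)) (word w) y.2) =
      (sumSplit₃ l fun b₁ b₂ b₃ => sgn k (sdeg x + wdeg b₁) *
        φ 1 x.2 (word b₁ * TensorAlgebra.ι k (M.m (word b₂)) * word b₃) y.2) +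
      sumSplit₃ l fun u v w => sgn k (sdeg x * (wdeg l + sdeg y)) *
        (sgn k (wdeg u) * φ (word u) (M.m (word v)) (word (w ++ [y])) x.2) := by
    rw [← sumSplit₃_add]
    refine sumSplit₃_congr fun u v w huv => ?_
    -- Closedness for the cyclic family x, u, m(v), w, y with x, m(v), y chosen. Skew symmetry turns
    -- the outer two terms into one from the rotated contraction and one from the bimodule relation.
    have hc := hφ.closed [] u w [] x (M.mHomog v) y
    have hs1 := hφ.skew (w ++ [y]) u x (M.mHomog v)
    have hs2 := hφ.skew (u ++ M.mHomog v :: w) [] y x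
    have hw : word u * TensorAlgebra.ι k (M.m (word v)) * word w =
        word (u ++ M.mHomog v :: w) := by
      rw [word_append, word_cons, mul_assoc]
      rfl
    rw [hw]
    simp only [List.nil_append, List.append_nil, word_nil] at hc hs1 hs2
    rw [hs1, hs2] at hc
    simp only [M.sdeg_mHomog, wdeg_append, wdeg_cons, wdeg_nil, zero_add, add_zero, mul_zero,
      sgn_zero, one_mul] at hc
    subst huv
    have e1 : sgn k (sdeg x + wdeg u) * (sgn k ((sdeg x + wdeg u + (wdeg v + 1)) * (wdeg w + sdeg y))
          * sgn k ((wdeg w + sdeg y + sdeg x) * (wdeg u + (wdeg v + 1)))) =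
        sgn k (sdeg x * (wdeg (u ++ (v ++ w)) + sdeg y)) * sgn k (wdeg u) := by
      simp only [← sgn_add]
      refine sgn_eq_of_even ⟨(wdeg u + wdeg v + 1) * (wdeg w + sdeg y) + sdeg x, ?_⟩
      simp only [wdeg_append]
      ring
    have e2 : sgn k (sdeg x * (wdeg u + (wdeg v + 1) + wdeg w + sdeg y)) *
        sgn k ((wdeg u + (wdeg v + 1 + wdeg w) + sdeg y) * sdeg x) = 1 := by
      rw [← sgn_add, ← sgn_zero]
      exact sgn_eq_of_even ⟨sdeg x * (wdeg u + wdeg v + 1 + wdeg w + sdeg y), by ring⟩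
    have hm : M.m (word v) = (M.mHomog v).2 := rfl
    rw [hm]
    linear_combination (sgn k (sdeg x + wdeg u)) * hc +
      e1 * φ (word u) (M.mHomog v).2 (word (w ++ [y])) x.2 +
      sgn k (sdeg x + wdeg u) * e2 * φ 1 x.2 (word (u ++ M.mHomog v :: w)) y.2
  rw [contraction_cons, contraction_concat, mul_add, mul_sumSplit₂, mul_sumSplit₃, h1, h2]
  simp only [sumSplit₃]
  linear_combination hb

/-- The contraction as a function of one cyclic word. -/
def contractionCyc (M : AInfAlgebra 𝒜) (φ : PreBimod k A) (l : List (Homog 𝒜)) : k :=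
  match l.getLast? with
  | none => 0
  | some y => contraction M φ l.dropLast y

theorem contractionCyc_concat (M : AInfAlgebra 𝒜) (φ : PreBimod k A) (l : List (Homog 𝒜))
    (y : Homog 𝒜) : contractionCyc M φ (l ++ [y]) = contraction M φ l y := by
  simp [contractionCyc]

/-- The letters of u are moved to the end one at a time. Moving x past the other letters of u and
back into the total exponent leaves an even discrepancy. -/
theorem contractionCyc_rotate {M : AInfAlgebra 𝒜} {φ : PreBimod k A}
    (hφ : IsStrongHomotopyInnerProduct M φ) (u v : List (Homog 𝒜)) :
    contractionCyc M φ (u ++ v) = sgn k (wdeg u * wdeg v) * contractionCyc M φ (v ++ u) := by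
  induction u generalizing v with
  | nil => simp [wdeg_nil, sgn_zero]
  | cons x u ih =>
    -- The one-letter rotation needs a last letter after x; a word consisting of x alone is its own
    -- rotation.
    rcases List.eq_nil_or_concat' (u ++ v) with h | ⟨w, y, h⟩
    · obtain ⟨rfl, rfl⟩ := List.append_eq_nil_iff.1 h
      simp [wdeg_nil, sgn_zero]
    · have h1 := contraction_rotate hφ x w y
      rw [← contractionCyc_concat, ← contractionCyc_concat, List.cons_append, ← h] at h1
      have hd := congrArg wdeg h
      simp only [wdeg_append, wdeg_cons, wdeg_nil, add_zero] at hd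
      rw [List.cons_append, h1, List.append_assoc, ih, ← hd, ← mul_assoc, ← sgn_add]
      simp only [wdeg_append, wdeg_cons, wdeg_nil, List.append_assoc, List.singleton_append]
      congr 1
      exact sgn_eq_of_even ⟨sdeg x * wdeg u, by ring⟩

theorem potCoeff_eq (M : AInfAlgebra 𝒜) (φ : PreBimod k A) (l : List (Homog 𝒜)) :
    potCoeff M φ l = (l.length : k)⁻¹ * contractionCyc M φ l := by
  rcases List.eq_nil_or_concat' l with rfl | ⟨w, y, rfl⟩
  · simp [potCoeff, contractionCyc]
  · simp [potCoeff, contractionCyc, contraction]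

end Graded

/-! ### Polynomials attached to functions on words, Euler's formula, and substitution. -/

section Series

variable {k : Type*} [Field k] {A : Type*} [AddCommGroup A] [Module k A]
  {B : Type*} [AddCommGroup B] [Module k B] {𝒜 : ℤ → Submodule k A} {ℬ : ℤ → Submodule k B}
  {ι κ : Type*} [Fintype κ]

theorem GCPoly.mon_append {deg : ι → ℤ} (I J : List ι) :
    GCPoly.mon k deg (I ++ J) = GCPoly.mon k deg I * GCPoly.mon k deg J := by
  simp [GCPoly.mon]

theorem GCPoly.mon_cons {deg : ι → ℤ} (i : ι) (J : List ι) :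
    GCPoly.mon k deg (i :: J) = GCPoly.var k deg i * GCPoly.mon k deg J := by
  simp [GCPoly.mon]

/-- The polynomial `∑ T(f_{j₁}, …, f_{jₙ}) y_{j₁} ⋯ y_{jₙ}`. -/
def HomogBasis.poly (f : HomogBasis ℬ κ) (n : ℕ) (T : List (Homog ℬ) → k) :
    GCPoly k f.varDeg :=
  wordSum n fun J => T (J.map f.elt) • GCPoly.mon k f.varDeg J

theorem HomogBasis.poly_congr (f : HomogBasis ℬ κ) {n : ℕ} {T T' : List (Homog ℬ) → k}
    (h : ∀ l, l.length = n → T l = T' l) : f.poly n T = f.poly n T' :=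
  wordSum_congr fun l hl => by rw [h _ (by rw [List.length_map, hl])]

theorem HomogBasis.poly_zero (f : HomogBasis ℬ κ) (n : ℕ) : f.poly n (fun _ => 0) = 0 := by
  simp [HomogBasis.poly, wordSum]

theorem HomogBasis.poly_add (f : HomogBasis ℬ κ) (n : ℕ) (T T' : List (Homog ℬ) → k) :
    f.poly n (fun l => T l + T' l) = f.poly n T + f.poly n T' := by
  simp [HomogBasis.poly, wordSum, add_smul, Finset.sum_add_distrib]

theorem HomogBasis.poly_smul (f : HomogBasis ℬ κ) (n : ℕ) (c : k) (T : List (Homog ℬ) → k) :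
    f.poly n (fun l => c * T l) = c • f.poly n T := by
  simp [HomogBasis.poly, wordSum, mul_smul, Finset.smul_sum]

theorem HomogBasis.poly_sum {σ : Type*} (s : Finset σ) (f : HomogBasis ℬ κ) (n : ℕ)
    (T : σ → List (Homog ℬ) → k) :
    f.poly n (fun l => ∑ i ∈ s, T i l) = ∑ i ∈ s, f.poly n (T i) := by
  simp only [HomogBasis.poly, wordSum, Finset.sum_smul]
  rw [Finset.sum_comm]

theorem HomogBasis.poly_sumSplit₂ (f : HomogBasis ℬ κ) (n : ℕ)
    (g : List (Homog ℬ) → List (Homog ℬ) → k) :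
    f.poly n (fun l => sumSplit₂ l g) = wordSum n fun J => sumSplit₂ J fun u v =>
      g (u.map f.elt) (v.map f.elt) • (GCPoly.mon k f.varDeg u * GCPoly.mon k f.varDeg v) := by
  refine wordSum_congr fun J _ => ?_
  beta_reduce
  rw [sumSplit₂_map]
  have := map_sumSplit₂ (LinearMap.toSpanSingleton k _ (GCPoly.mon k f.varDeg J)) J
    fun u v => g (u.map f.elt) (v.map f.elt)
  simp only [LinearMap.toSpanSingleton_apply] at this
  rw [this]
  refine sumSplit₂_congr fun u v huv => ?_
  rw [← GCPoly.mon_append, huv]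

/-- Rotating cyclic words does not change the associated polynomial. -/
theorem HomogBasis.poly_rotate (f : HomogBasis ℬ κ) (n : ℕ)
    (g : List (Homog ℬ) → List (Homog ℬ) → k) :
    f.poly n (fun l => sumSplit₂ l g) =
      f.poly n fun l => sumSplit₂ l fun u v => sgn k (wdeg u * wdeg v) * g v u := by
  rw [f.poly_sumSplit₂, f.poly_sumSplit₂, wordSum_sumSplit₂_swap]
  refine wordSum_congr fun J _ => sumSplit₂_congr fun u v _ => ?_
  -- The variables have the negatives of the shifted degrees, so commuting two monomials gives
  -- exactly the Koszul sign of the words.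
  rw [GCPoly.mon_mul_mon v u, smul_smul, mul_comm (sgn k _), f.sum_varDeg, f.sum_varDeg,
    neg_mul_neg, mul_comm (wdeg (v.map f.elt))]

/-- Euler's formula for a cyclically symmetric function `c` of `m + 1` blocks. -/
theorem HomogBasis.poly_sumBlocks_weight (f : HomogBasis ℬ κ) (n m : ℕ)
    (c : List (List (Homog ℬ)) → k)
    (hc : ∀ L L', c (L ++ L') = sgn k (wdeg L.flatten * wdeg L'.flatten) * c (L' ++ L))
    (a b : ℕ) (hab : a + b = m + 1) :
    (f.poly n fun l => sumSplit₂ l fun u v => (v.length : k) *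
        sumBlocks a u fun L => sumBlocks b v fun L' => c (L ++ L')) =
      (b : k) • f.poly n fun l => sumSplit₂ l fun u v => (v.length : k) *
        sumBlocks m u fun L => c (L ++ [v]) := by
  -- The left side weights a decomposition into m + 1 blocks by the total length of its last b
  -- blocks; the induction removes these one by one.
  induction b generalizing a with
  | zero =>
    rw [Nat.cast_zero, zero_smul, ← f.poly_zero n]
    refine f.poly_congr fun l _ => ?_
    rw [← sumSplit₂_zero (M := k) l]
    refine sumSplit₂_congr fun u v _ => ?_
    cases v <;> simp [sumBlocks, sumBlocks_zero]
  | succ b ih =>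
    -- Let z be the first of the last b + 1 blocks: their total length is that of z plus that of the
    -- remaining b.
    have h1 : (f.poly n fun l => sumSplit₂ l fun u v => (v.length : k) *
        sumBlocks a u fun L => sumBlocks (b + 1) v fun L' => c (L ++ L')) =
        (f.poly n fun l => sumSplit₂ l fun r v => sumSplit₂ r fun u z => (z.length : k) *
          sumBlocks a u fun L => sumBlocks b v fun L' => c (L ++ z :: L')) +
        f.poly n fun l => sumSplit₂ l fun u v => (v.length : k) *
          sumBlocks (a + 1) u fun L => sumBlocks b v fun L' => c (L ++ L') := by
      rw [← f.poly_add]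
      refine f.poly_congr fun l _ => ?_
      have h2 : ∀ r v : List (Homog ℬ), (v.length : k) *
          (sumBlocks (a + 1) r fun L => sumBlocks b v fun L' => c (L ++ L')) =
          sumSplit₂ r fun u z => (v.length : k) *
            sumBlocks a u fun L => sumBlocks b v fun L' => c (L ++ z :: L') := by
        intro r v
        rw [sumBlocks_succ', mul_sumSplit₂]
        simp only [List.append_assoc, List.singleton_append]
      simp only [h2]
      rw [← sumSplit₂_add]
      simp only [← sumSplit₂_add]
      rw [sumSplit₂_assoc]
      refine sumSplit₂_congr fun u v _ => ?_
      simp only [sumBlocks_succ, sumBlocks_sumSplit₂, mul_sumSplit₂]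
      refine sumSplit₂_congr fun z v' hv => ?_
      rw [← hv, List.length_append, Nat.cast_add, add_mul]
    rw [h1, ih (a + 1) (by omega), Nat.cast_succ, add_smul, one_smul, add_comm]
    congr 1
    -- The word is rotated so that z becomes the last block; the sign cancels against the one from
    -- `hc`.
    rw [f.poly_rotate]
    refine f.poly_congr fun l _ => ?_
    obtain rfl : m = b + a := by omega
    have h3 : ∀ u v : List (Homog ℬ), (v.length : k) *
        (sumBlocks (b + a) u fun L => c (L ++ [v])) =
        sumSplit₂ u fun u₁ u₂ => (v.length : k) *
          sumBlocks b u₁ fun L => sumBlocks a u₂ fun L' => c (L ++ (L' ++ [v])) := by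
      intro u v
      rw [sumBlocks_add, mul_sumSplit₂]
      simp only [List.append_assoc]
    simp only [h3]
    rw [sumSplit₂_assoc]
    refine sumSplit₂_congr fun v r _ => ?_
    rw [mul_sumSplit₂]
    refine sumSplit₂_congr fun u z hr => ?_
    rw [mul_left_comm]
    congr 1
    rw [sumBlocks_comm]
    simp only [mul_sumBlocks]
    refine sumBlocks_congr fun L' _ hL' => sumBlocks_congr fun L _ hL => ?_
    have h5 : L ++ z :: L' = (L ++ [z]) ++ L' := by simp
    rw [h5, hc (L ++ [z]) L', ← mul_assoc, List.flatten_append, hL, hL']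
    simp only [List.flatten_singleton, hr]
    rw [mul_comm (wdeg r), sgn_mul_self, one_mul]

/-! ### Multilinearity -/

/-- A function on words of homogeneous elements which is linear in each letter. -/
def IsMultilinear (T : List (Homog 𝒜) → k) : Prop :=
  ∀ (u v : List (Homog 𝒜)) (d : ℤ), ∃ T' : 𝒜 d →ₗ[k] k, ∀ a, T (u ++ ⟨d, a⟩ :: v) = T' a

/-- Meant for coefficients such as signs and lengths, which see a letter only through its degree. -/
theorem IsMultilinear.smul {T : List (Homog 𝒜) → k} (hT : IsMultilinear T) (c : List (Homog 𝒜) → k)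
    (hc : ∀ (u v : List (Homog 𝒜)) (d : ℤ) (a a' : 𝒜 d), c (u ++ ⟨d, a⟩ :: v) = c (u ++ ⟨d, a'⟩ :: v)) :
    IsMultilinear fun l => c l * T l := by
  intro u v d
  obtain ⟨T', h⟩ := hT u v d
  exact ⟨c (u ++ ⟨d, 0⟩ :: v) • T', fun a => by simp [h, hc u v d a 0]⟩

theorem isMultilinear_word (g : TensorAlgebra k A →ₗ[k] k) :
    IsMultilinear fun l : List (Homog 𝒜) => g (word l) := by
  intro u v d
  refine ⟨g ∘ₗ LinearMap.mulLeft k (word u) ∘ₗ LinearMap.mulRight k (word v) ∘ₗ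
    TensorAlgebra.ι k ∘ₗ (𝒜 d).subtype, fun a => ?_⟩
  simp [word_append, word_cons]

theorem IsMultilinear.cons {T : List (Homog 𝒜) → k} (hT : IsMultilinear T) (x : Homog 𝒜) :
    IsMultilinear fun l => T (x :: l) :=
  fun u v d => hT (x :: u) v d

theorem isMultilinear_sumSplit₂ {f : List (Homog 𝒜) → List (Homog 𝒜) → k}
    (h₁ : ∀ v, IsMultilinear fun u => f u v) (h₂ : ∀ u, IsMultilinear (f u)) :
    IsMultilinear fun l => sumSplit₂ l f := by
  intro u v d
  induction u generalizing f with
  | nil =>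
    obtain ⟨T, hT⟩ := h₂ [] [] v d
    choose S hS using fun p q => h₁ q [] p d
    refine ⟨T + sumSplit₂ v S, fun a => ?_⟩
    simp only [List.nil_append] at hT hS ⊢
    rw [sumSplit₂_cons, hT, LinearMap.add_apply]
    simp only [hS]
    simp [sumSplit₂]
  | cons x u ih =>
    obtain ⟨T, hT⟩ := h₂ [] (x :: u) v d
    obtain ⟨S, hS⟩ := ih (f := fun p q => f (x :: p) q) (fun q => (h₁ q).cons x) fun p => h₂ _
    refine ⟨T + S, fun a => ?_⟩
    beta_reduce at hS ⊢
    rw [List.cons_append, sumSplit₂_cons, hS, ← List.cons_append, hT, LinearMap.add_apply]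

theorem isMultilinear_contraction (M : AInfAlgebra 𝒜) (φ : PreBimod k A) (y : Homog 𝒜) :
    IsMultilinear fun l => contraction M φ l y := by
  have hl : ∀ w : List (Homog 𝒜), IsMultilinear fun u : List (Homog 𝒜) => sumSplit₂ w fun v w =>
      sgn k (wdeg u) * φ (word u) (M.m (word v)) (word w) y.2 := by
    intro w
    have := (isMultilinear_word (𝒜 := 𝒜) (sumSplit₂ w fun v w =>
      LinearMap.applyₗ (y.2 : A) ∘ₗ LinearMap.applyₗ (word w) ∘ₗ
        LinearMap.applyₗ (M.m (word v)) ∘ₗ φ)).smul (fun u => sgn k (wdeg u)) (by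
          intro u v d a a'
          simp [wdeg_append, wdeg_cons, sdeg])
    convert this using 2 with u
    simp [sumSplit₂, Finset.mul_sum]
  refine isMultilinear_sumSplit₂ hl fun u => isMultilinear_sumSplit₂ (fun w => ?_) fun v => ?_
  · exact isMultilinear_word (sgn k (wdeg u) • (LinearMap.applyₗ (y.2 : A) ∘ₗ
      LinearMap.applyₗ (word w) ∘ₗ φ (word u) ∘ₗ M.m))
  · exact isMultilinear_word (sgn k (wdeg u) • (LinearMap.applyₗ (y.2 : A) ∘ₗ
      φ (word u) (M.m (word v))))

theorem isMultilinear_contractionCyc (M : AInfAlgebra 𝒜) (φ : PreBimod k A) :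
    IsMultilinear (contractionCyc M φ) := by
  intro u v d
  rcases List.eq_nil_or_concat' v with rfl | ⟨w, y, rfl⟩
  -- The varying letter is the last one, hence the argument of the functional; otherwise it is an
  -- input of the contraction.
  · refine ⟨sumSplit₃ u (fun u v w => sgn k (wdeg u) • φ (word u) (M.m (word v)) (word w)) ∘ₗ
      (𝒜 d).subtype, fun a => ?_⟩
    rw [contractionCyc_concat]
    simp [contraction, sumSplit₃, sumSplit₂]
  · obtain ⟨T, hT⟩ := isMultilinear_contraction M φ y u w d
    refine ⟨T, fun a => ?_⟩
    beta_reduce at hT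
    rw [← List.cons_append, ← List.append_assoc, contractionCyc_concat, hT]

theorem isMultilinear_potCoeff (M : AInfAlgebra 𝒜) (φ : PreBimod k A) :
    IsMultilinear (potCoeff M φ) := by
  have := (isMultilinear_contractionCyc M φ).smul (fun l => (l.length : k)⁻¹)
    (by intros; simp)
  convert this using 2 with l
  exact potCoeff_eq M φ l

theorem IsMultilinear.apply_cons [Fintype ι] [DirectSum.Decomposition 𝒜] {T : List (Homog 𝒜) → k}
    (hT : IsMultilinear T) (e : HomogBasis 𝒜 ι) (x : Homog 𝒜) (v : List (Homog 𝒜)) :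
    T (x :: v) = ∑ i, e.basis.repr x.2 i * T (e.elt i :: v) := by
  classical
  obtain ⟨d, a⟩ := x
  obtain ⟨T', hT'⟩ := hT [] v d
  simp only [List.nil_append] at hT'
  -- The expansion must stay inside `𝒜 d`, since T accepts homogeneous letters only; coordinates
  -- along basis vectors of other degrees vanish.
  have ha : a = ∑ i, if h : e.deg i = d then
      e.basis.repr a i • (⟨e.basis i, h ▸ e.mem i⟩ : 𝒜 d) else 0 := by
    apply Subtype.ext
    rw [AddSubmonoidClass.coe_finsetSum]
    conv_lhs => rw [← e.basis.sum_repr (a : A)]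
    refine Finset.sum_congr rfl fun i _ => ?_
    split_ifs with h
    · rfl
    · rw [e.repr_eq_zero a.2 h, zero_smul]
      rfl
  rw [hT']
  conv_lhs => rw [ha]
  rw [map_sum]
  refine Finset.sum_congr rfl fun i _ => ?_
  split_ifs with h
  · rw [map_smul, smul_eq_mul, ← hT']
    subst h
    rfl
  · rw [map_zero, e.repr_eq_zero a.2 h, zero_mul]

/-- The change of coordinates on polynomials given by multilinear functions. -/
theorem coeff_coordHom_poly [Fintype ι] [DirectSum.Decomposition 𝒜] {M : AInfAlgebra 𝒜}
    {N : AInfAlgebra ℬ} (F : AInfHom N M) (e : HomogBasis 𝒜 ι) (f : HomogBasis ℬ κ)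
    {T : List (Homog 𝒜) → k} (hT : IsMultilinear T) (m n : ℕ) :
    PowerSeries.coeff n (coordHom F e f (e.poly m T)).1 =
      f.poly n fun l => sumBlocks m l fun L => T (L.map F.hHomog) := by
  induction m generalizing n T with
  | zero =>
    have : e.poly 0 T = algebraMap k _ (T []) := by
      simp [HomogBasis.poly, wordSum, GCPoly.mon, Algebra.algebraMap_eq_smul_one]
    rw [this, AlgHom.commutes]
    change PowerSeries.coeff n (algebraMap k (PowerSeries _) (T [])) = _
    rw [PowerSeries.algebraMap_apply, PowerSeries.coeff_C]
    cases n with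
    | zero =>
      simp [HomogBasis.poly, wordSum, GCPoly.mon, sumBlocks, Algebra.algebraMap_eq_smul_one]
    | succ n =>
      rw [if_neg n.succ_ne_zero, ← f.poly_zero (n + 1)]
      refine f.poly_congr fun l hl => ?_
      cases l with
      | nil => simp at hl
      | cons x l => simp [sumBlocks]
  | succ m ih =>
    -- The first variable is split off: substituting for it produces the first block, and the
    -- induction hypothesis the others.
    have h1 : e.poly (m + 1) T =
        ∑ i, GCPoly.var k e.varDeg i * e.poly m fun l => T (e.elt i :: l) := by
      rw [HomogBasis.poly, wordSum_succ]
      refine Finset.sum_congr rfl fun i _ => ?_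
      rw [HomogBasis.poly, wordSum, wordSum, Finset.mul_sum]
      refine Finset.sum_congr rfl fun I _ => ?_
      rw [GCPoly.mon_cons, mul_smul_comm, List.map_cons]
    rw [h1, map_sum]
    simp only [map_mul, coordHom_var, sumBlocks_succ]
    rw [f.poly_sumSplit₂, wordSum_sumSplit₂, AddSubmonoidClass.coe_finsetSum, map_sum]
    simp only [MulMemClass.coe_mul, PowerSeries.coeff_mul]
    rw [Finset.sum_comm]
    refine Finset.sum_congr rfl fun p _ => ?_
    have h2 : ∀ i, PowerSeries.coeff p.1 (coordSeries F e f i).1 =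
        f.poly p.1 fun l => e.basis.repr (F.h (word l)) i := fun i => by
      simp only [coordSeries, GCSeries.ofCoeff, PowerSeries.coeff_mk]
      rfl
    simp only [h2, fun i => ih (hT.cons (e.elt i))]
    simp only [HomogBasis.poly, wordSum, Finset.sum_mul_sum]
    rw [Finset.sum_comm]
    refine Finset.sum_congr rfl fun I _ => ?_
    rw [Finset.sum_comm]
    refine Finset.sum_congr rfl fun J _ => ?_
    simp only [smul_mul_smul_comm, ← Finset.sum_smul]
    congr 1
    -- By linearity in the first letter, the sum over i reassembles h of the first block from its
    -- coordinates.
    simp only [List.map_cons, hT.apply_cons e (F.hHomog _)]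
    rw [sumBlocks_sum]
    refine Finset.sum_congr rfl fun i _ => ?_
    rw [mul_sumBlocks]
    rfl

end Series

/-! ### Regrouping iterated splittings around a middle piece. -/

section Words

variable {α M : Type*} [AddCommMonoid M]

theorem sumAllBlocks_sumSplit₂ {β : Type*} (l : List α) (l' : List β)
    (F : List (List α) → List β → List β → M) :
    sumAllBlocks l (fun L => sumSplit₂ l' (F L)) =
      sumSplit₂ l' fun u v => sumAllBlocks l fun L => F L u v := by
  simp only [sumAllBlocks, sumBlocks_sumSplit₂, sumSplit₂_sum]

/-- Regrouping `(u v) w (x y)` as `u (v w x) y`. -/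
theorem sumSplit₃_regroup (l : List α)
    (f : List α → List α → List α → List α → List α → M) :
    sumSplit₃ l (fun a w b => sumSplit₂ a fun u v => sumSplit₂ b fun x y => f u v w x y) =
      sumSplit₃ l fun u c y => sumSplit₃ c fun v w x => f u v w x y := by
  simp only [sumSplit₃]
  calc
    _ = sumSplit₂ l fun a r => sumSplit₂ a fun u v => sumSplit₂ r fun w b => sumSplit₂ b fun x y =>
        f u v w x y := sumSplit₂_congr fun a r _ => sumSplit₂_comm r a _
    _ = _ := by
      rw [sumSplit₂_assoc]
      refine sumSplit₂_congr fun u r _ => ?_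
      rw [sumSplit₂_assoc]
      exact sumSplit₂_congr fun v r _ => (sumSplit₂_assoc r _).symm

theorem sumSplit₃_regroup₂ (l : List α)
    (f : List α → List α → List α → List α → List α → List α → List α → M) :
    sumSplit₃ l (fun a w b => sumSplit₃ a fun u₁ u₂ u₃ => sumSplit₃ b fun v₁ v₂ v₃ =>
        f u₁ u₂ u₃ w v₁ v₂ v₃) =
      sumSplit₃ l fun u₁ c v₃ => sumSplit₃ c fun u₂ d v₂ => sumSplit₃ d fun u₃ w v₁ =>
        f u₁ u₂ u₃ w v₁ v₂ v₃ := by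
  simp only [← sumSplit₃_regroup _ fun u₂ u₃ w v₁ v₂ => f _ u₂ u₃ w v₁ v₂ _]
  rw [← sumSplit₃_regroup l fun u₁ s w t v₃ => sumSplit₂ s fun u₂ u₃ => sumSplit₂ t fun v₁ v₂ =>
    f u₁ u₂ u₃ w v₁ v₂ v₃]
  refine sumSplit₃_congr fun a w b _ => sumSplit₂_congr fun u₁ s _ => ?_
  rw [← sumSplit₂_comm]
  refine sumSplit₂_congr fun u₂ u₃ _ => ?_
  exact (sumSplit₂_assoc b _).symm

end Words

/-! ### Pulling back the one-form ι_Q Ω along h. -/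

section Graded

variable {k : Type*} [Field k] {A : Type*} [AddCommGroup A] [Module k A]
  {B : Type*} [AddCommGroup B] [Module k B] {𝒜 : ℤ → Submodule k A} {ℬ : ℤ → Submodule k B}
  {MA : AInfAlgebra 𝒜} {MB : AInfAlgebra ℬ}

theorem IsMultilinear.map_hHomog_eq_zero {T : List (Homog 𝒜) → k} (hT : IsMultilinear T)
    (F : AInfHom MB MA) {L : List (List (Homog ℬ))} (hL : [] ∈ L) : T (L.map F.hHomog) = 0 := by
  obtain ⟨s, t, rfl⟩ := List.append_of_mem hL
  obtain ⟨T', hT'⟩ := hT (s.map F.hHomog) (t.map F.hHomog) (wdeg ([] : List (Homog ℬ)) + 1)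
  have h0 : (⟨F.h (word []), F.h_degree []⟩ : 𝒜 (wdeg ([] : List (Homog ℬ)) + 1)) = 0 :=
    Subtype.ext F.h_zero
  rw [List.map_append, List.map_cons, AInfHom.hHomog, hT', h0, map_zero]

/-- By compatibility with deconcatenation and linearity in each slot, the sum over blocks becomes ĥ
in each of the three slots; the sign depends only on the degree of u, which h preserves. -/
theorem sumAllBlocks_contraction (φ : PreBimod k A) (F : AInfHom MB MA) (l : List (Homog ℬ))
    (y : Homog 𝒜) :
    sumAllBlocks l (fun L => contraction MA φ (L.map F.hHomog) y) =
      sumSplit₃ l fun u v w => sgn k (wdeg u) *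
        φ (hatMap F.h u) (MA.m (hatMap F.h v)) (hatMap F.h w) y.2 := by
  have h0 : ∀ L : List (List (Homog ℬ)), [] ∈ L → word (L.map F.hHomog) = 0 :=
    fun L hL => F.word_map_hHomog_eq_zero hL
  simp only [contraction, sumSplit₃_map]
  simp only [sumSplit₃]
  rw [sumAllBlocks_split]
  · refine sumSplit₂_congr fun u r _ => ?_
    have h1 : ∀ L : List (List (Homog ℬ)), (sumAllBlocks r fun L' => sumSplit₂ L' fun v w =>
        sgn k (wdeg (L.map F.hHomog)) * φ (word (L.map F.hHomog)) (MA.m (word (v.map F.hHomog)))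
          (word (w.map F.hHomog)) y.2) =
        sumSplit₂ r fun v w => sgn k (wdeg (L.map F.hHomog)) *
          φ (word (L.map F.hHomog)) (MA.m (hatMap F.h v)) (hatMap F.h w) y.2 := by
      intro L
      rw [sumAllBlocks_split]
      · refine sumSplit₂_congr fun v w _ => ?_
        have e2 := map_sumAllBlocks (sgn k (wdeg (L.map F.hHomog)) • (LinearMap.applyₗ (y.2 : A) ∘ₗ
          LinearMap.applyₗ (hatMap F.h w) ∘ₗ φ (word (L.map F.hHomog)) ∘ₗ MA.m)) v
          fun L' => word (L'.map F.hHomog)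
        rw [← F.hatMap_eq] at e2
        simp only [LinearMap.smul_apply, LinearMap.comp_apply, LinearMap.applyₗ_apply_apply,
          smul_eq_mul] at e2
        rw [e2]
        refine sumAllBlocks_congr fun L' _ => ?_
        have e3 := map_sumAllBlocks (sgn k (wdeg (L.map F.hHomog)) • (LinearMap.applyₗ (y.2 : A) ∘ₗ
          φ (word (L.map F.hHomog)) (MA.m (word (L'.map F.hHomog))))) w
          fun L' => word (L'.map F.hHomog)
        rw [← F.hatMap_eq] at e3
        simp only [LinearMap.smul_apply, LinearMap.comp_apply, LinearMap.applyₗ_apply_apply,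
          smul_eq_mul] at e3
        rw [e3]
      · intro L₁ L₂ h
        simp [h0 _ h]
      · intro L₁ L₂ h
        simp [h0 _ h]
    simp only [h1]
    rw [sumAllBlocks_sumSplit₂]
    refine sumSplit₂_congr fun v w _ => ?_
    have e1 := map_sumAllBlocks (sgn k (wdeg u) • (LinearMap.applyₗ (y.2 : A) ∘ₗ
      LinearMap.applyₗ (hatMap F.h w) ∘ₗ LinearMap.applyₗ (MA.m (hatMap F.h v)) ∘ₗ φ)) u
      fun L' => word (L'.map F.hHomog)
    rw [← F.hatMap_eq] at e1
    simp only [LinearMap.smul_apply, LinearMap.comp_apply, LinearMap.applyₗ_apply_apply,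
      smul_eq_mul] at e1
    rw [e1]
    refine sumAllBlocks_congr fun L hL => ?_
    rw [F.wdeg_map_hHomog, hL]
  · intro L L' h
    simp [h0 _ h, sumSplit₂_zero]
  · intro L L' h
    rw [← sumSplit₂_zero (M := k) L']
    refine sumSplit₂_congr fun v w hv => ?_
    rw [← hv, List.mem_append] at h
    rcases h with h | h <;> simp [h0 _ h]

/-- The one-form `ι_Q Ω` pulls back to `ι_Q (h^* Ω)`, as `h` is an A∞-morphism. -/
theorem sumSplit₃_pullBimod (φ : PreBimod k A) (F : AInfHom MB MA) (l : List (Homog ℬ))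
    (y : Homog ℬ) :
    sumSplit₃ l (fun u v w => sgn k (wdeg u) * pullBimod F φ u (MB.mHomog v) w y) =
      sumSplit₃ l fun u v w => sgn k (wdeg u * (wdeg v + wdeg w + sdeg y)) *
        sumAllBlocks v fun L =>
          contraction MA φ (L.map F.hHomog) (F.hHomog (w ++ y :: u)) := by
  have hL : sumSplit₃ l (fun u v w => sgn k (wdeg u) * pullBimod F φ u (MB.mHomog v) w y) =
      sumSplit₃ l fun a v b => sumSplit₃ a fun u₁ u₂ u₃ => sumSplit₃ b fun w₁ w₂ w₃ =>
        sgn k (wdeg u₁ * (wdeg u₂ + wdeg u₃ + wdeg v + wdeg w₁ + wdeg w₂ + wdeg w₃ + sdeg y)) *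
          (sgn k (wdeg u₂) * (sgn k (wdeg u₃) *
          φ (hatMap F.h u₂) (F.h (word (u₃ ++ MB.mHomog v :: w₁))) (hatMap F.h w₂)
            (F.h (word (w₃ ++ y :: u₁))))) := by
    refine sumSplit₃_congr fun a v b _ => ?_
    rw [pullBimod, mul_sumSplit₃]
    refine sumSplit₃_congr fun u₁ u₂ u₃ ha => ?_
    rw [mul_sumSplit₃]
    refine sumSplit₃_congr fun w₁ w₂ w₃ hb => ?_
    rw [← ha, ← hb, ← mul_assoc, ← mul_assoc, ← mul_assoc, ← sgn_add, ← sgn_add, ← sgn_add]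
    congr 1
    -- As m(v) has shifted degree |v|' + 1, the pull-back sign has an extra |u₁|', which cancels the
    -- |u₁|' in the outer sign.
    refine sgn_eq_of_even ⟨wdeg u₁, ?_⟩
    simp only [wdeg_append, MB.sdeg_mHomog]
    ring
  -- The outermost pieces u₁ and w₃ share a block with y. The innermost part d = u₃ v w₁ is the word
  -- to which the morphism relation applies.
  rw [hL, sumSplit₃_regroup₂ l fun u₁ u₂ u₃ v w₁ w₂ w₃ =>
    sgn k (wdeg u₁ * (wdeg u₂ + wdeg u₃ + wdeg v + wdeg w₁ + wdeg w₂ + wdeg w₃ + sdeg y)) *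
      (sgn k (wdeg u₂) * (sgn k (wdeg u₃) *
      φ (hatMap F.h u₂) (F.h (word (u₃ ++ MB.mHomog v :: w₁))) (hatMap F.h w₂)
        (F.h (word (w₃ ++ y :: u₁)))))]
  refine sumSplit₃_congr fun u₁ c w₃ _ => ?_
  rw [sumAllBlocks_contraction, mul_sumSplit₃]
  refine sumSplit₃_congr fun u₂ d w₂ hc => ?_
  change _ = _ * (_ * φ _ _ _ (F.h (word (w₃ ++ y :: u₁))))
  -- Here h intertwines the vector fields: m(ĥ(d)) is the signed sum of h(u₃, m(v), w₁).
  rw [← F.h_rel]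
  simp only [sumSplit₃]
  have e := fun (d : List (Homog ℬ)) f => map_sumSplit₂ (LinearMap.applyₗ
    (F.h (word (w₃ ++ y :: u₁))) ∘ₗ LinearMap.applyₗ (hatMap F.h w₂) ∘ₗ φ (hatMap F.h u₂)) d f
  simp only [LinearMap.comp_apply, LinearMap.applyₗ_apply_apply] at e
  simp only [e, mul_sumSplit₂]
  refine sumSplit₂_congr fun u₃ r hd => sumSplit₂_congr fun v w₁ hr => ?_
  have hw : word u₃ * TensorAlgebra.ι k (MB.m (word v)) * word w₁ =
      word (u₃ ++ MB.mHomog v :: w₁) := by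
    rw [word_append, word_cons, mul_assoc]
    rfl
  have hs : wdeg u₂ + wdeg u₃ + wdeg v + wdeg w₁ + wdeg w₂ + wdeg w₃ + sdeg y =
      wdeg c + wdeg w₃ + sdeg y := by
    rw [← hc, ← hd, ← hr]
    simp only [wdeg_append]
    ring
  rw [hw, hs]
  simp

/-- Only ψ_{0,0} is non-zero, so m must take the whole word. -/
theorem CyclicInnerProduct.sumSplit₃_toBimod (c : CyclicInnerProduct MB) (l : List (Homog ℬ))
    (y : Homog ℬ) :
    sumSplit₃ l (fun u v w =>
      sgn k (wdeg u) * c.toBimod (word u) (MB.mHomog v).2 (word w) y.2) =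
      c.form (MB.m (word l)) y.2 := by
  rw [sumSplit₃, sumSplit₂_eq_left, sumSplit₂_eq_right]
  · simp [c.toBimod_apply, word_nil, wdeg_nil, sgn_zero, AInfAlgebra.mHomog]
  · intro u a v
    simp [c.toBimod_apply, word_cons, TensorAlgebra.algebraMapInv]
  · intro a u v
    simp [c.toBimod_apply, word_cons, TensorAlgebra.algebraMapInv, sumSplit₂_zero]

/-- The block fed to the functional wraps around the end of the cyclic word: it is w followed by u.
The condition that w is non-empty records that this block contains the last letter of l, the marked
letter. -/
theorem cyclicPotCoeff_eq {φ : PreBimod k A} {F : AInfHom MB MA} {c : CyclicInnerProduct MB}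
    (hF : SquareCommutes F φ c.toBimod) (l : List (Homog ℬ)) :
    cyclicPotCoeff c l = (l.length : k)⁻¹ * sumSplit₂ l fun u r => sgn k (wdeg u * wdeg r) *
      sumSplit₂ r fun v w => if w = [] then 0 else
        sumAllBlocks v fun L => contraction MA φ (L.map F.hHomog) (F.hHomog (w ++ u)) := by
  rcases List.eq_nil_or_concat' l with rfl | ⟨l, y, rfl⟩
  · simp [cyclicPotCoeff]
  · have h := c.sumSplit₃_toBimod l y
    simp only [hF _ _ (MB.mHomog _)] at h
    rw [sumSplit₃_pullBimod] at h
    rw [sumSplit₂_concat, sumSplit₂_nil]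
    simp only [cyclicPotCoeff, List.getLast?_append, List.getLast?_singleton, Option.some_or,
      List.dropLast_concat, ← h, if_true, mul_zero, add_zero]
    congr 1
    refine sumSplit₂_congr fun u r _ => ?_
    rw [sumSplit₂_concat, mul_add, mul_sumSplit₂]
    simp only [if_true, mul_zero, add_zero]
    refine sumSplit₂_congr fun v w hr => ?_
    rw [if_neg (by simp), ← hr]
    simp [wdeg_append, wdeg_cons, wdeg_nil, add_assoc]

/-! ### Comparison of the two potentials degree by degree. -/

variable {ι κ : Type*} [Fintype ι] [Fintype κ]

/-- Rotating u to the end makes the wrapped block contiguous. The summand then depends only on that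
block and not on where the marked letter sits in it, so every decomposition is counted once per
letter of its last block. -/
theorem poly_cyclicPotCoeff {φ : PreBimod k A} {F : AInfHom MB MA} {c : CyclicInnerProduct MB}
    (hF : SquareCommutes F φ c.toBimod) (f : HomogBasis ℬ κ) (n : ℕ) :
    f.poly n (cyclicPotCoeff c) = (n : k)⁻¹ • ∑ m ∈ Finset.range n, f.poly n fun l =>
      sumSplit₂ l fun u v => (v.length : k) *
        sumBlocks m u fun L => contractionCyc MA φ ((L ++ [v]).map F.hHomog) := by
  have h1 : f.poly n (cyclicPotCoeff c) = f.poly n fun l => (n : k)⁻¹ *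
      sumSplit₂ l fun u r => sgn k (wdeg u * wdeg r) *
      sumSplit₂ r fun v w => if w = [] then 0 else
        sumAllBlocks v fun L => contraction MA φ (L.map F.hHomog) (F.hHomog (w ++ u)) :=
    f.poly_congr fun l hl => by rw [cyclicPotCoeff_eq hF, hl]
  rw [h1, f.poly_smul, ← f.poly_rotate n fun r u => sumSplit₂ r fun v w => if w = [] then 0 else
        sumAllBlocks v fun L => contraction MA φ (L.map F.hHomog) (F.hHomog (w ++ u)),
    ← f.poly_sum]
  congr 1
  refine f.poly_congr fun l hl => ?_
  rw [sumSplit₂_assoc, ← sumSplit₂_sum]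
  refine sumSplit₂_congr fun u v huv => ?_
  have h2 : (sumSplit₂ v fun w z => if w = [] then 0 else
      sumAllBlocks u fun L => contraction MA φ (L.map F.hHomog) (F.hHomog (w ++ z))) =
      sumSplit₂ v fun w _ => if w = [] then 0 else
      sumAllBlocks u fun L => contraction MA φ (L.map F.hHomog) (F.hHomog v) :=
    sumSplit₂_congr fun w z h => by rw [h]
  rw [h2, sumSplit₂_ne_nil, nsmul_eq_mul, ← Finset.mul_sum]
  rcases eq_or_ne v [] with rfl | hv
  · simp
  congr 1
  simp only [List.map_append, List.map_singleton, contractionCyc_concat]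
  -- The last block v is non-empty, so u has fewer than n letters and the uniform bound n on its
  -- number of blocks suffices.
  refine sumAllBlocks_eq ?_ fun L hL => ?_
  · rw [← hl, ← huv, List.length_append]
    have := List.length_pos_iff.2 hv
    omega
  · exact (isMultilinear_contraction MA φ _).map_hHomog_eq_zero F hL

/-- Euler's formula taken over all m + 1 blocks: their total length is n, and characteristic 0
allows division by n and by m + 1. -/
theorem poly_potCoeff [CharZero k] {φ : PreBimod k A} (hφ : IsStrongHomotopyInnerProduct MA φ)
    (F : AInfHom MB MA) (f : HomogBasis ℬ κ) {m n : ℕ} (hn : n ≠ 0) :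
    (f.poly n fun l => sumBlocks (m + 1) l fun L => potCoeff MA φ (L.map F.hHomog)) =
      (n : k)⁻¹ • f.poly n fun l => sumSplit₂ l fun u v => (v.length : k) *
        sumBlocks m u fun L => contractionCyc MA φ ((L ++ [v]).map F.hHomog) := by
  -- With a = 0 the first part is empty, so the weight on the left is the length n of the whole
  -- word.
  have h := f.poly_sumBlocks_weight n m (fun L => contractionCyc MA φ (L.map F.hHomog))
    (fun L L' => by
      rw [List.map_append, contractionCyc_rotate hφ, F.wdeg_map_hHomog, F.wdeg_map_hHomog,
        List.map_append]) 0 (m + 1) (zero_add _)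
  have h1 : (f.poly n fun l => sumSplit₂ l fun u v => (v.length : k) * sumBlocks 0 u fun L =>
      sumBlocks (m + 1) v fun L' => contractionCyc MA φ ((L ++ L').map F.hHomog)) =
      f.poly n fun l => (n : k) * sumBlocks (m + 1) l fun L =>
        contractionCyc MA φ (L.map F.hHomog) := by
    refine f.poly_congr fun l hl => ?_
    rw [sumSplit₂_eq_left fun a u v => by simp [sumBlocks], hl]
    simp [sumBlocks]
  have h2 : (f.poly n fun l => sumBlocks (m + 1) l fun L => potCoeff MA φ (L.map F.hHomog)) =
      f.poly n fun l => ((m + 1 : ℕ) : k)⁻¹ * sumBlocks (m + 1) l fun L =>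
        contractionCyc MA φ (L.map F.hHomog) := by
    refine f.poly_congr fun l _ => ?_
    rw [mul_sumBlocks]
    refine sumBlocks_congr fun L hL _ => ?_
    rw [potCoeff_eq, List.length_map, hL]
  rw [h1, f.poly_smul] at h
  rw [h2, f.poly_smul]
  have hn' : (n : k) ≠ 0 := Nat.cast_ne_zero.2 hn
  have hm' : ((m + 1 : ℕ) : k) ≠ 0 := Nat.cast_ne_zero.2 m.succ_ne_zero
  rw [inv_smul_eq_iff₀ hm', smul_comm, ← h, inv_smul_smul₀ hn']

theorem cyclicPotential_eq_pullback [CharZero k] [DirectSum.Decomposition 𝒜] {φ : PreBimod k A}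
    (hφ : IsStrongHomotopyInnerProduct MA φ) (F : AInfHom MB MA) (c : CyclicInnerProduct MB)
    (hF : SquareCommutes F φ c.toBimod) (e : HomogBasis 𝒜 ι) (f : HomogBasis ℬ κ) :
    cyclicPotential c f = pullback F e f (potential MA φ e) := by
  apply Subtype.ext
  refine PowerSeries.ext fun n => ?_
  have hl : PowerSeries.coeff n (cyclicPotential c f).1 = f.poly n (cyclicPotCoeff c) := by
    simp only [cyclicPotential, GCSeries.ofCoeff, PowerSeries.coeff_mk]
    rfl
  have hr : ∀ m, PowerSeries.coeff m (potential MA φ e).1 = e.poly m (potCoeff MA φ) := by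
    intro m
    simp only [potential, GCSeries.ofCoeff, PowerSeries.coeff_mk]
    rfl
  rw [hl, pullback, PowerSeries.coeff_mk]
  simp only [hr, coeff_coordHom_poly F e f (isMultilinear_potCoeff MA φ)]
  -- The index shifts by one: m blocks besides the marked one correspond to the part of Φ^A of
  -- degree m + 1, and Φ^A has no constant term.
  rw [poly_cyclicPotCoeff hF, Finset.sum_range_succ', Finset.smul_sum]
  have h0 : (f.poly n fun l => sumBlocks 0 l fun L => potCoeff MA φ (L.map F.hHomog)) = 0 := by
    rw [← f.poly_zero n]
    refine f.poly_congr fun l _ => ?_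
    cases l <;> simp [sumBlocks, potCoeff]
  rw [h0, add_zero]
  refine Finset.sum_congr rfl fun m hm => (poly_potCoeff hφ F f ?_).symm
  have := Finset.mem_range.1 hm
  omega

end Graded

end HCyc

end

theorem mainTheorem1 {k : Type*} [Field k] [CharZero k]
    {A B : Type*} [AddCommGroup A] [Module k A] [AddCommGroup B] [Module k B]
    {𝒜 : ℤ → Submodule k A} [DirectSum.Decomposition 𝒜]
    {ℬ : ℤ → Submodule k B} [DirectSum.Decomposition ℬ]
    (MA : AInfAlgebra 𝒜) (φ : PreBimod k A) (hφ : IsStrongHomotopyInnerProduct MA φ)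
    (MB : AInfAlgebra ℬ) (c : CyclicInnerProduct MB)
    (h : AInfHom MB MA) (hh : h.IsQuasiIso)
    (hcomm : SquareCommutes h φ c.toBimod)
    {ι κ : Type*} [Fintype ι] [Fintype κ]
    (e : HomogBasis 𝒜 ι) (f : HomogBasis ℬ κ) :
    cyclicPotential c f = pullback h e f (potential MA φ e) :=
  cyclicPotential_eq_pullback hφ h c hcomm e f
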